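/- Let $X,Y,Z$ be random variables on finite alphabets $\mathcal X,\mathcal Y,\mathcal Z$ with joint law $P_{XYZ}$; all logarithms are to base 2. Alice, Bob and Willie observe $X^n$, $Y^n$, $Z^n$, where $(X_i,Y_i,Z_i)$ are i.i.d. with law $P_{XYZ}$. Alice and Bob hold private randomness taking finitely many values, independent of each other and of $(X^n,Y^n,Z^n)$. They exchange $r$ public symbols $F=(F_1,\dots,F_r)\in\mathcal X^r$ over a noiseless channel that Willie observes as well; $r$ is arbitrary. For each $i$, a fixed one of the two terminals sends $F_i$, as a function of its own observation, its own private randomness and $F_1,\dots,F_{i-1}$. At the end Alice and Bob compute keys $K$ and $\hat K$ in a set of size $L=\lceil 2^{nR}\rceil$, each from its own observation, its own private randomness and $F$. For the meaningless signal, Willie's observation has law $Q_{Z^nF}(z^n,f)=\prod_{i=1}^n P_Z(z_i)\cdot|\mathcal X|^{-r}$, i.e. the discussion consists of i.i.d. uniform symbols independent of $Z^n$. A rate $R\ge 0$ is called stealthily achievable if for every $\epsilon>0$ and all sufficiently large $n$ there is such a protocol with $$\Pr(K\ne\hat K)\le\epsilon,\qquad \log L-H(K)\le\epsilon,\qquad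 D(P_{KZ^nF}\|P_KP_{Z^nF})+D(P_{Z^nF}\|Q_{Z^nF})\le\epsilon .$$ It is called achievable if the same holds with the last condition replaced by $D(P_{KZ^nF}\|P_KP_{Z^nF})\le\epsilon$. The stealthy secret-key capacity $C_{SK}^{\mathrm{Eff}}$ and the secret-key capacity $C_{SK}$ are the suprema of the stealthily achievable rates and of the achievable rates, respectively. If $X-Y-Z$ is a Markov chain, then $$C_{SK}^{\mathrm{Eff}}=I(X;Y)-I(X;Z),$$ and also $C_{SK}=I(X;Y)-I(X;Z)$, so the stealth constraint does not reduce the capacity. -/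

import Mathlib

namespace StealthyKey

noncomputable section

/-! ### Finite probability: laws, entropy, divergence, mutual information (base 2) -/

/-- The law of the random variable `f` on a finite sample space whose outcome `ω` has
probability `w ω`. -/
def law {Ω β : Type*} [Fintype Ω] (w : Ω → ℝ) (f : Ω → β) (b : β) : ℝ :=
  open Classical in ∑ ω, if f ω = b then w ω else 0

/-- Shannon entropy, in bits, of a probability mass function on a finite set. -/
def entropy {α : Type*} [Fintype α] (p : α → ℝ) : ℝ :=
  -∑ a, p a * Real.logb 2 (p a)

/-- Divergence `D(p ‖ q)`, in bits, of two mass functions on a finite set; it is `⊤` if `p` is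
not absolutely continuous with respect to `q`. (A term with `p a = 0` contributes `0`.) -/
def divergence {α : Type*} [Fintype α] (p q : α → ℝ) : EReal :=
  open Classical in
  if ∀ a, q a = 0 → p a = 0 then ((∑ a, p a * Real.logb 2 (p a / q a) : ℝ) : EReal) else ⊤

/-- Mutual information `I(A;B)`, in bits, of two random variables on a finite sample space. -/
def mutualInfo {Ω α β : Type*} [Fintype Ω] [Fintype α] [Fintype β] (w : Ω → ℝ)
    (A : Ω → α) (B : Ω → β) : ℝ :=
  ∑ a, ∑ b, law w (fun ω => (A ω, B ω)) (a, b) *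
    Real.logb 2 (law w (fun ω => (A ω, B ω)) (a, b) / (law w A a * law w B b))

/-! ### The source -/

section Source

variable {X Y Z : Type*}

/-- The real-valued joint mass function `P_{XYZ}` of the source. -/
def pXYZ (P : PMF (X × Y × Z)) (s : X × Y × Z) : ℝ := (P s).toReal

variable [Fintype X] [Fintype Y] [Fintype Z]

/-- `P_Z`. -/
def pZ (P : PMF (X × Y × Z)) (z : Z) : ℝ := law (pXYZ P) (fun s => s.2.2) z

/-- `I(X;Y)`. -/
def infoXY (P : PMF (X × Y × Z)) : ℝ := mutualInfo (pXYZ P) (fun s => s.1) (fun s => s.2.1)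

/-- `I(X;Z)`. -/
def infoXZ (P : PMF (X × Y × Z)) : ℝ := mutualInfo (pXYZ P) (fun s => s.1) (fun s => s.2.2)

/-- `X - Y - Z` is a Markov chain:
`P_{XYZ}(x,y,z) P_Y(y) = P_{XY}(x,y) P_{YZ}(y,z)` for all `x, y, z`. -/
def IsMarkovChain (P : PMF (X × Y × Z)) : Prop :=
  ∀ x y z, pXYZ P (x, y, z) * law (pXYZ P) (fun s => s.2.1) y =
    law (pXYZ P) (fun s => (s.1, s.2.1)) (x, y) * law (pXYZ P) (fun s => s.2) (y, z)

end Source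

/-! ### Secret-key generation by public discussion -/

/-- A secret-key generation protocol with block length `n`, public discussion `F ∈ X ^ r` and key
alphabet of size `L`. Alice observes `X ^ n` and private randomness, Bob observes `Y ^ n` and
private randomness. The symbols `F_0, …, F_{r-1}` are sent one after the other over a noiseless
public channel by the terminal whose turn it is, each as a function of the sender's own
observations and of the past discussion. At the end Alice computes `K` and Bob computes `K̂`. -/
structure Protocol (X Y : Type*) (n r L : ℕ) where
  /-- size of the alphabet of Alice's private randomness -/
  sizeA : ℕ
  /-- size of the alphabet of Bob's private randomness -/
  sizeB : ℕ
  /-- law of Alice's private randomness -/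
  randA : PMF (Fin sizeA)
  /-- law of Bob's private randomness -/
  randB : PMF (Fin sizeB)
  /-- `true` if Alice sends the `i`-th public symbol, `false` if Bob does -/
  aliceSpeaks : Fin r → Bool
  /-- Alice's encoders -/
  sendA : (i : Fin r) → (Fin n → X) → Fin sizeA → (Fin i → X) → X
  /-- Bob's encoders -/
  sendB : (i : Fin r) → (Fin n → Y) → Fin sizeB → (Fin i → X) → X
  /-- Alice's key `K` -/
  keyA : (Fin n → X) → Fin sizeA → (Fin r → X) → Fin L
  /-- Bob's key `K̂` -/
  keyB : (Fin n → Y) → Fin sizeB → (Fin r → X) → Fin L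

namespace Protocol

variable {X Y Z : Type*} {n r L : ℕ}

/-- The first `k` public symbols, given all observations. -/
def discussionUpTo (S : Protocol X Y n r L) (x : Fin n → X) (a : Fin S.sizeA)
    (y : Fin n → Y) (b : Fin S.sizeB) : (k : ℕ) → k ≤ r → (Fin k → X)
  | 0, _ => Fin.elim0
  | k + 1, h =>
    let past := discussionUpTo S x a y b k (Nat.le_of_succ_le h)
    Fin.snoc past
      (if S.aliceSpeaks ⟨k, h⟩ then S.sendA ⟨k, h⟩ x a past else S.sendB ⟨k, h⟩ y b past)

/-- Sample space: the source sequence together with the private randomness of both terminals. -/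
abbrev Outcome (S : Protocol X Y n r L) (Z : Type*) : Type _ :=
  (Fin n → X × Y × Z) × Fin S.sizeA × Fin S.sizeB

/-- Probability of an outcome: the source is i.i.d. with law `P`, and the private randomness of
Alice, that of Bob, and the source are mutually independent. -/
def weight (S : Protocol X Y n r L) (P : PMF (X × Y × Z)) (ω : S.Outcome Z) : ℝ :=
  (∏ i, pXYZ P (ω.1 i)) * (S.randA ω.2.1).toReal * (S.randB ω.2.2).toReal

/-- The public discussion `F`. -/
def discussion (S : Protocol X Y n r L) (ω : S.Outcome Z) : Fin r → X :=
  S.discussionUpTo (fun i => (ω.1 i).1) ω.2.1 (fun i => (ω.1 i).2.1) ω.2.2 r le_rfl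

/-- Alice's key `K`. -/
def key (S : Protocol X Y n r L) (ω : S.Outcome Z) : Fin L :=
  S.keyA (fun i => (ω.1 i).1) ω.2.1 (S.discussion ω)

/-- Bob's key `K̂`. -/
def keyHat (S : Protocol X Y n r L) (ω : S.Outcome Z) : Fin L :=
  S.keyB (fun i => (ω.1 i).2.1) ω.2.2 (S.discussion ω)

/-- Willie's observation `(Z ^ n, F)`. -/
def observation (S : Protocol X Y n r L) (ω : S.Outcome Z) : (Fin n → Z) × (Fin r → X) :=
  (fun i => (ω.1 i).2.2, S.discussion ω)

variable [Fintype X] [Fintype Y] [Fintype Z]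

/-- `Pr(K ≠ K̂)`. -/
def errorProb (S : Protocol X Y n r L) (P : PMF (X × Y × Z)) : ℝ :=
  open Classical in ∑ ω : S.Outcome Z, if S.key ω ≠ S.keyHat ω then S.weight P ω else 0

/-- `P_K`. -/
def keyLaw (S : Protocol X Y n r L) (P : PMF (X × Y × Z)) : Fin L → ℝ :=
  law (S.weight P) S.key

/-- `P_{Z^n F}`, the law of Willie's observation for the meaningful signal. -/
def observationLaw (S : Protocol X Y n r L) (P : PMF (X × Y × Z)) :
    (Fin n → Z) × (Fin r → X) → ℝ :=
  law (S.weight P) S.observation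

/-- `P_{K Z^n F}`. -/
def jointLaw (S : Protocol X Y n r L) (P : PMF (X × Y × Z)) :
    Fin L × ((Fin n → Z) × (Fin r → X)) → ℝ :=
  law (S.weight P) (fun ω => (S.key ω, S.observation ω))

/-- Non-confusion `D(P_{K Z^n F} ‖ P_K P_{Z^n F})`. -/
def nonConfusion (S : Protocol X Y n r L) (P : PMF (X × Y × Z)) : EReal :=
  divergence (S.jointLaw P) (fun t => S.keyLaw P t.1 * S.observationLaw P t.2)

end Protocol

section Capacity

variable {X Y Z : Type*} [Fintype X] [Fintype Y] [Fintype Z]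

/-- `Q_{Z^n F}`, the law of Willie's observation for the meaningless signal: the source is i.i.d.
and, independently of it, the public channel carries i.i.d. uniform symbols. -/
def meaninglessLaw (P : PMF (X × Y × Z)) (n r : ℕ) (t : (Fin n → Z) × (Fin r → X)) : ℝ :=
  (∏ i, pZ P (t.1 i)) * ∏ _j : Fin r, (1 / (Fintype.card X : ℝ))

/-- The conceptual wiretap channel `P_{ZF|U}` to Willie, where `F = U ⊕ X` and the input `U` is
independent of the source. -/
def wiretapChannel [AddGroup X] (P : PMF (X × Y × Z)) (u : X) (t : Z × X) : ℝ :=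
  law (pXYZ P) (fun s => (s.2.2, u + s.1)) t

theorem sum_wiretapChannel [AddGroup X] (P : PMF (X × Y × Z)) (t : Z × X) :
    ∑ u, wiretapChannel P u t = pZ P t.1 := by
  classical
  obtain ⟨z, f⟩ := t
  simp only [wiretapChannel, pZ, law, Prod.mk.injEq]
  rw [Finset.sum_comm]
  refine Finset.sum_congr rfl fun s _ => ?_
  have h : ∀ u : X, (s.2.2 = z ∧ u + s.1 = f) ↔ (u = f - s.1 ∧ s.2.2 = z) := fun u => by
    rw [eq_sub_iff_add_eq, and_comm]
  simp only [h]
  by_cases hz : s.2.2 = z <;> simp [hz]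

/-- Whatever the group law `⊕` on `X`, for `r = n` the meaningless law is the output law
`Q_{Z^n F} = ∑_{u^n} P_{Z^n F|U^n}(z^n, f^n | u^n) P_{U^n}(u^n)` of the memoryless conceptual
wiretap channel with uniform input `U^n`. -/
theorem meaninglessLaw_eq_wiretap_output [AddGroup X] (P : PMF (X × Y × Z)) (n : ℕ)
    (t : (Fin n → Z) × (Fin n → X)) :
    meaninglessLaw P n n t =
      ∑ u : Fin n → X, (∏ i, wiretapChannel P (u i) (t.1 i, t.2 i)) *
        ∏ _i : Fin n, (1 / (Fintype.card X : ℝ)) := by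
  classical
  rw [meaninglessLaw, ← Finset.sum_mul]
  congr 1
  rw [← Fintype.prod_sum (fun i u => wiretapChannel P u (t.1 i, t.2 i))]
  simp only [sum_wiretapChannel]

/-- Non-stealth `D(P_{Z^n F} ‖ Q_{Z^n F})`. -/
def Protocol.nonStealth {n r L : ℕ} (S : Protocol X Y n r L) (P : PMF (X × Y × Z)) : EReal :=
  divergence (S.observationLaw P) (meaninglessLaw P n r)

/-- `R` is an achievable stealthy secret-key rate: for every `ε > 0` and all large `n` there is a
protocol with key alphabet of size `⌈2 ^ (n R)⌉` that meets the error, uniformity and effective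
secrecy constraints. The length `r` of the public discussion is not limited. -/
def StealthyAchievable (P : PMF (X × Y × Z)) (R : ℝ) : Prop :=
  0 ≤ R ∧ ∀ ε : ℝ, 0 < ε → ∀ᶠ n : ℕ in Filter.atTop,
    ∃ (r : ℕ) (S : Protocol X Y n r ⌈(2 : ℝ) ^ ((n : ℝ) * R)⌉₊),
      S.errorProb P ≤ ε ∧
      Real.logb 2 (⌈(2 : ℝ) ^ ((n : ℝ) * R)⌉₊ : ℝ) - entropy (S.keyLaw P) ≤ ε ∧
      S.nonConfusion P + S.nonStealth P ≤ (ε : EReal)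

/-- `R` is an achievable secret-key rate without the stealth constraint. -/
def Achievable (P : PMF (X × Y × Z)) (R : ℝ) : Prop :=
  0 ≤ R ∧ ∀ ε : ℝ, 0 < ε → ∀ᶠ n : ℕ in Filter.atTop,
    ∃ (r : ℕ) (S : Protocol X Y n r ⌈(2 : ℝ) ^ ((n : ℝ) * R)⌉₊),
      S.errorProb P ≤ ε ∧
      Real.logb 2 (⌈(2 : ℝ) ^ ((n : ℝ) * R)⌉₊ : ℝ) - entropy (S.keyLaw P) ≤ ε ∧
      S.nonConfusion P ≤ (ε : EReal)

/-- The stealthy secret-key capacity: the supremum of the achievable stealthy rates. -/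
def stealthyCapacity (P : PMF (X × Y × Z)) : EReal :=
  ⨆ (R : ℝ) (_ : StealthyAchievable P R), (R : EReal)

/-- The secret-key capacity without the stealth constraint. -/
def secretKeyCapacity (P : PMF (X × Y × Z)) : EReal :=
  ⨆ (R : ℝ) (_ : Achievable P R), (R : EReal)

end Capacity

end

end StealthyKey

namespace StealthyKey

/-! ### Laws of random variables on a finite sample space -/

section Law

variable {Ω β γ : Type*} [Fintype Ω] [Fintype β] [Fintype γ]

/-! Converse. Compare the true law with the law `q` that makes X^n and Y^n conditionally independent
given Z^n and keeps the (X,Z) and (Y,Z) marginals. The divergence between them is n I(X;Y|Z), and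
the Markov property turns this into n (I(X;Y) - I(X;Z)) (`condMutualInfo_eq`). Interaction creates
no dependence under `q`: the event F = f is a condition on Alice's data together with a condition on
Bob's (`Protocol.discussion_eq_iff`), so the two keys stay conditionally independent given Z^n and F
(`Protocol.law_keys_observation`). Data processing merged with Fano's inequality (`condEntropy_le`)
then bounds H(K|Z^n,F) in one stroke, without a round-by-round argument and for any r. Since
divergence is nonnegative, the stealth constraint can only lower the capacity.

Achievability. A random function sends X^n to a pair (K,F), where F is made public. The divergence
of the law of (K,F,Z^n) from uniform times P_{Z^n} is exactly the sum of non-confusion, non-stealth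
and log L - H(K) (`exists_protocol_of_binning`). Hence privacy amplification for the whole pair, not
just for K, yields stealth at no cost in rate. Decoding needs F to have rate above H(X|Y);
near-uniformity needs the rate of F plus R to be below H(X|Z). Both fit when R < H(X|Z) - H(X|Y) =
I(X;Y) - I(X;Z). Both defects are bounded by fractional moments that factor over the coordinates
(`exists_binning`), and a small exponent makes each single-letter moment less than one
(`exists_moment_lt_one`), so they decay exponentially. -/

theorem sum_law_mul (w : Ω → ℝ) (f : Ω → β) (φ : β → ℝ) :
    ∑ b, law w f b * φ b = ∑ ω, w ω * φ (f ω) := by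
  classical
  simp only [law, Finset.sum_mul]
  rw [Finset.sum_comm]
  refine Finset.sum_congr rfl fun ω _ => ?_
  rw [Finset.sum_eq_single (f ω)]
  · simp
  · intro b _ hb
    simp [Ne.symm hb]
  · simp

theorem sum_law (w : Ω → ℝ) (f : Ω → β) : ∑ b, law w f b = ∑ ω, w ω := by
  simpa using sum_law_mul w f (fun _ => 1)

theorem law_congr {Ω β γ : Type*} [Fintype Ω] (w : Ω → ℝ) {f : Ω → β} {g : Ω → γ} {b : β} {c : γ}
    (h : ∀ ω, f ω = b ↔ g ω = c) : law w f b = law w g c := by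
  classical
  refine Finset.sum_congr rfl fun ω _ => ?_
  by_cases hb : f ω = b
  · rw [if_pos hb, if_pos ((h ω).1 hb)]
  · rw [if_neg hb, if_neg fun hc => hb ((h ω).2 hc)]

theorem law_nonneg {w : Ω → ℝ} (hw : ∀ ω, 0 ≤ w ω) {β : Type*} (f : Ω → β) (b : β) :
    0 ≤ law w f b := by
  classical
  refine Finset.sum_nonneg fun ω _ => ?_
  split_ifs
  exacts [hw ω, le_rfl]

theorem le_law {w : Ω → ℝ} (hw : ∀ ω, 0 ≤ w ω) {β : Type*} (f : Ω → β) (ω : Ω) :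
    w ω ≤ law w f (f ω) := by
  classical
  have h := Finset.single_le_sum (f := fun ω' => if f ω' = f ω then w ω' else 0)
    (fun ω' _ => by split_ifs; exacts [hw ω', le_rfl]) (Finset.mem_univ ω)
  simpa [law] using h

theorem law_pos {w : Ω → ℝ} (hw : ∀ ω, 0 ≤ w ω) {β : Type*} (f : Ω → β) {ω : Ω} (h : w ω ≠ 0) :
    0 < law w f (f ω) :=
  ((hw ω).lt_of_ne h.symm).trans_le (le_law hw f ω)

theorem exists_of_law_ne_zero {w : Ω → ℝ} {β : Type*} {f : Ω → β} {b : β} (h : law w f b ≠ 0) :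
    ∃ ω, f ω = b ∧ w ω ≠ 0 := by
  classical
  obtain ⟨ω, -, hω⟩ := Finset.exists_ne_zero_of_sum_ne_zero h
  by_cases hf : f ω = b
  · exact ⟨ω, hf, by simpa [hf] using hω⟩
  · simp [hf] at hω

theorem sum_law_pair_left (w : Ω → ℝ) {γ : Type*} (f : Ω → β) (g : Ω → γ) (c : γ) :
    ∑ b, law w (fun ω => (f ω, g ω)) (b, c) = law w g c := by
  classical
  simp only [law, Prod.mk.injEq]
  rw [Finset.sum_comm]
  refine Finset.sum_congr rfl fun ω _ => ?_
  by_cases h : g ω = c <;> simp [h]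

/-- Nonnegativity of divergence for finite (sub-)mass functions. -/
theorem gibbs {p q : β → ℝ} (hp : ∀ b, 0 ≤ p b) (hq : ∀ b, 0 ≤ q b) (h : ∑ b, q b ≤ ∑ b, p b)
    (hpq : ∀ b, p b ≠ 0 → q b ≠ 0) : 0 ≤ ∑ b, p b * Real.logb 2 (p b / q b) := by
  -- The pointwise bound p log(p/q) ≥ p - q, from log x ≥ 1 - 1/x at x = p/q.
  have key : ∀ b, (p b - q b) / Real.log 2 ≤ p b * Real.logb 2 (p b / q b) := fun b => by
    have hl : 0 < Real.log 2 := Real.log_pos one_lt_two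
    by_cases h0 : p b = 0
    · simp only [h0, zero_sub, zero_mul]
      exact div_nonpos_of_nonpos_of_nonneg (by linarith [hq b]) hl.le
    have hp' := (hp b).lt_of_ne (Ne.symm h0)
    have hq' := (hq b).lt_of_ne (Ne.symm (hpq b h0))
    rw [Real.logb, ← mul_div_assoc]
    refine div_le_div_of_nonneg_right ?_ hl.le
    have h1 := Real.one_sub_inv_le_log_of_pos (div_pos hp' hq')
    have h2 := mul_le_mul_of_nonneg_left h1 hp'.le
    rwa [inv_div, mul_sub, mul_one, mul_div_cancel₀ _ h0] at h2
  refine le_trans ?_ (Finset.sum_le_sum fun b _ => key b)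
  rw [← Finset.sum_div, Finset.sum_sub_distrib]
  exact div_nonneg (by linarith) (Real.log_nonneg one_le_two)

/-- Gibbs' inequality written as an expectation over the sample space, so that inequalities for
different random variables can be added outcome by outcome. -/
theorem gibbs_law {w : Ω → ℝ} (hw : ∀ ω, 0 ≤ w ω) (f : Ω → β) {q : β → ℝ} (hq : ∀ b, 0 ≤ q b)
    (h : ∑ b, q b ≤ ∑ ω, w ω) (hwq : ∀ ω, w ω ≠ 0 → q (f ω) ≠ 0) :
    0 ≤ ∑ ω, w ω * Real.logb 2 (law w f (f ω) / q (f ω)) := by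
  rw [← sum_law_mul w f (fun b => Real.logb 2 (law w f b / q b))]
  refine gibbs (law_nonneg hw f) hq (by rwa [sum_law]) fun b hb => ?_
  obtain ⟨ω, rfl, hω⟩ := exists_of_law_ne_zero hb
  exact hwq ω hω

theorem divergence_law {w : Ω → ℝ} (f : Ω → β) {q : β → ℝ} (hwq : ∀ ω, w ω ≠ 0 → q (f ω) ≠ 0) :
    divergence (law w f) q =
      ((∑ ω, w ω * Real.logb 2 (law w f (f ω) / q (f ω)) : ℝ) : EReal) := by
  classical
  rw [divergence, if_pos, sum_law_mul w f (fun b => Real.logb 2 (law w f b / q b))]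
  intro b hb
  by_contra h
  obtain ⟨ω, rfl, hω⟩ := exists_of_law_ne_zero h
  exact hwq ω hω hb

theorem divergence_nonneg {p q : β → ℝ} (hp : ∀ b, 0 ≤ p b) (hq : ∀ b, 0 ≤ q b)
    (h : ∑ b, q b ≤ ∑ b, p b) : 0 ≤ divergence p q := by
  classical
  rw [divergence]
  split_ifs with hac
  · exact EReal.coe_nonneg.2 (gibbs hp hq h fun b hb hb' => hb (hac b hb'))
  · exact le_top

theorem entropy_law (w : Ω → ℝ) (f : Ω → β) :
    entropy (law w f) = -∑ ω, w ω * Real.logb 2 (law w f (f ω)) := by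
  rw [entropy, sum_law_mul w f (fun b => Real.logb 2 (law w f b))]

theorem sum_prod_eq_pow {S : Type*} [Fintype S] (n : ℕ) (g : S → ℝ) :
    ∑ s : Fin n → S, ∏ i, g (s i) = (∑ s, g s) ^ n := by
  classical
  rw [← Fintype.prod_sum (fun (_ : Fin n) s => g s)]
  simp

/-- The law of a coordinatewise function of an i.i.d. sequence. -/
theorem law_iid {S : Type*} [Fintype S] {n : ℕ} (p : S → ℝ) {β : Type*} (f : S → β)
    (t : Fin n → β) :
    law (fun s : Fin n → S => ∏ i, p (s i)) (fun s i => f (s i)) t = ∏ i, law p f (t i) := by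
  classical
  simp only [law]
  rw [Fintype.prod_sum (fun (i : Fin n) s => if f s = t i then p s else 0)]
  refine Finset.sum_congr rfl fun s _ => ?_
  rw [Finset.prod_ite_zero]
  simp [funext_iff]

/-- Additivity: the mean of a sum over the coordinates of an i.i.d. sequence. -/
theorem sum_iid_mul_sum {S : Type*} [Fintype S] (n : ℕ) {p : S → ℝ} (hp : ∑ s, p s = 1)
    (g : S → ℝ) :
    ∑ s : Fin n → S, (∏ i, p (s i)) * ∑ i, g (s i) = n * ∑ s, p s * g s := by
  classical
  simp only [Finset.mul_sum]
  rw [Finset.sum_comm]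
  have h : ∀ j : Fin n, ∑ s : Fin n → S, (∏ i, p (s i)) * g (s j) = ∑ s, p s * g s := fun j => by
    have h1 : ∀ s : Fin n → S, (∏ i, p (s i)) * g (s j) =
        ∏ i, p (s i) * (if i = j then g (s i) else 1) := fun s => by
      rw [Finset.prod_mul_distrib]; simp
    simp only [h1]
    rw [← Fintype.prod_sum (fun (i : Fin n) s => p s * (if i = j then g s else 1)),
      Finset.prod_eq_single j]
    · simp
    · intro i _ hi
      simp [hi, hp]
    · simp
  simp [h, Finset.mul_sum]

end Law

/-! ### The source and the private randomness -/

section Weight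

theorem sum_toReal_pmf {S : Type*} [Fintype S] (p : PMF S) : ∑ s, (p s).toReal = 1 := by
  rw [← ENNReal.toReal_sum fun s _ => p.apply_ne_top s, ← tsum_fintype (L := .unconditional S),
    p.tsum_coe, ENNReal.toReal_one]

variable {X Y Z : Type*} {n r L : ℕ} (S : Protocol X Y n r L) (P : PMF (X × Y × Z))

theorem pXYZ_nonneg (s : X × Y × Z) : 0 ≤ pXYZ P s := ENNReal.toReal_nonneg

theorem Protocol.weight_nonneg (ω : S.Outcome Z) : 0 ≤ S.weight P ω :=
  mul_nonneg (mul_nonneg (Finset.prod_nonneg fun _ _ => pXYZ_nonneg P _) ENNReal.toReal_nonneg)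
    ENNReal.toReal_nonneg

variable [Fintype X] [Fintype Y] [Fintype Z]

theorem sum_pXYZ : ∑ s, pXYZ P s = 1 := sum_toReal_pmf P

/-- The private randomness does not affect the distribution of the source. -/
theorem Protocol.sum_randomness (p : (Fin n → X × Y × Z) → ℝ) :
    ∑ ω : S.Outcome Z, p ω.1 * (S.randA ω.2.1).toReal * (S.randB ω.2.2).toReal = ∑ s, p s := by
  rw [Fintype.sum_prod_type]
  refine Finset.sum_congr rfl fun s _ => ?_
  rw [Fintype.sum_prod_type]
  simp only [← Finset.mul_sum, sum_toReal_pmf, mul_one]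

theorem Protocol.sum_weight_mul (φ : (Fin n → X × Y × Z) → ℝ) :
    ∑ ω : S.Outcome Z, S.weight P ω * φ ω.1 = ∑ s, (∏ i, pXYZ P (s i)) * φ s := by
  rw [← S.sum_randomness]
  exact Finset.sum_congr rfl fun ω _ => by rw [Protocol.weight]; ring

theorem Protocol.sum_weight : ∑ ω : S.Outcome Z, S.weight P ω = 1 := by
  have h := S.sum_weight_mul P (fun _ => 1)
  simp only [mul_one] at h
  rw [h, sum_prod_eq_pow, sum_pXYZ, one_pow]

end Weight

/-! ### The converse -/

section Converse

variable {Ω κ γ : Type*} [Fintype Ω] [Fintype κ] [Fintype γ]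

/-- If `K` and `K'` are conditionally independent given `G` under `q`, the conditional entropy of
`K` given `G` under `w` is at most the divergence of `w` from `q` plus a Fano term. -/
theorem condEntropy_le [Nonempty κ] [DecidableEq κ] {w q : Ω → ℝ} (hw : ∀ ω, 0 ≤ w ω)
    (hq : ∀ ω, 0 ≤ q ω) (hw1 : ∑ ω, w ω = 1) (hq1 : ∑ ω, q ω ≤ 1) (hwq : ∀ ω, w ω ≠ 0 → q ω ≠ 0)
    (K K' : Ω → κ) (G : Ω → γ) (U V : γ → κ → ℝ) (hU : ∀ g k, 0 ≤ U g k) (hV : ∀ g k, 0 ≤ V g k)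
    (hUV : ∀ t : κ × κ × γ, law q (fun ω => (K ω, K' ω, G ω)) t = U t.2.2 t.1 * V t.2.2 t.2.1) :
    -∑ ω, w ω * Real.logb 2 (law w (fun ω => (K ω, G ω)) (K ω, G ω) / law w G (G ω)) ≤
      ∑ ω, w ω * Real.logb 2 (w ω / q ω) + 1 +
        (∑ ω, if K ω ≠ K' ω then w ω else 0) *
          Real.logb 2 (Fintype.card κ) := by
  classical
  have hc : (0 : ℝ) < Fintype.card κ := by exact_mod_cast Fintype.card_pos
  -- Fano's inequality as a guessing kernel for K given K': half of the mass sits on agreement, the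
  -- rest is spread uniformly. Then -log W is at most 1 on agreement and equals 1 + log |κ|
  -- otherwise.
  set W : κ → κ → ℝ := fun k k' => if k = k' then 1 / 2 else 1 / (2 * Fintype.card κ) with hWdef
  have hW : ∀ k k', 0 < W k k' := fun k k' => by
    simp only [hWdef]; split_ifs <;> positivity
  have hWsum : ∀ k', ∑ k, W k k' ≤ 1 := fun k' => by
    have : ∀ k, W k k' ≤ (if k = k' then 1 / 2 else 0) + 1 / (2 * Fintype.card κ : ℝ) := fun k => by
      simp only [hWdef]
      split_ifs
      · have : (0 : ℝ) < 1 / (2 * Fintype.card κ : ℝ) := by positivity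
        linarith
      · simp
    refine (Finset.sum_le_sum fun k _ => this k).trans ?_
    rw [Finset.sum_add_distrib]
    simp only [Finset.sum_ite_eq', Finset.mem_univ, if_true, Finset.sum_const, Finset.card_univ,
      nsmul_eq_mul]
    field_simp
    norm_num
  have hUVpos : ∀ ω, w ω ≠ 0 → 0 < U (G ω) (K ω) ∧ 0 < V (G ω) (K' ω) := fun ω hω => by
    have h1 := law_pos hq (fun ω => (K ω, K' ω, G ω)) (hwq ω hω)
    rw [hUV] at h1
    exact (pos_and_pos_or_neg_and_neg_of_mul_pos h1).resolve_right
      fun h => absurd h.1 (not_lt.2 (hU _ _))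
  -- `Ub g * V g k'` is the marginal of (G, K') under `q`, and `U g k / Ub g` is the conditional law
  -- of K given G.
  set Ub : γ → ℝ := fun g => ∑ k, U g k with hUb
  have hUle : ∀ g k, U g k ≤ Ub g := fun g k =>
    Finset.single_le_sum (f := U g) (fun k _ => hU g k) (Finset.mem_univ k)
  have hUb0 : ∀ g, 0 ≤ Ub g := fun g => Finset.sum_nonneg fun k _ => hU g k
  set p := law w (fun ω => (K ω, G ω)) with hp
  set p' := law w (fun ω => (G ω, K' ω)) with hp'
  have hp'0 : ∀ t, 0 ≤ p' t := law_nonneg hw _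
  have hqsum : ∑ t : κ × κ × γ, U t.2.2 t.1 * V t.2.2 t.2.1 ≤ 1 := by
    simp only [← hUV]
    rwa [sum_law]
  -- comparison of `w` with the tilted law
  have G1 : 0 ≤ ∑ ω, w ω * Real.logb 2
      (w ω / (q ω * (p' (G ω, K' ω) * W (K ω) (K' ω) / (V (G ω) (K' ω) * U (G ω) (K ω))))) := by
    refine gibbs hw (fun ω => ?_) ?_ (fun ω hω => ?_)
    · have := hp'0 (G ω, K' ω)
      have := hU (G ω) (K ω)
      have := hV (G ω) (K' ω)
      have := (hW (K ω) (K' ω)).le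
      have := hq ω
      positivity
    · rw [hw1, ← sum_law_mul q (fun ω => (K ω, K' ω, G ω))
        (fun t => p' (t.2.2, t.2.1) * W t.1 t.2.1 / (V t.2.2 t.2.1 * U t.2.2 t.1))]
      have h1 : ∀ t : κ × κ × γ, law q (fun ω => (K ω, K' ω, G ω)) t *
          (p' (t.2.2, t.2.1) * W t.1 t.2.1 / (V t.2.2 t.2.1 * U t.2.2 t.1)) ≤
            p' (t.2.2, t.2.1) * W t.1 t.2.1 := fun t => by
        have hnn : 0 ≤ p' (t.2.2, t.2.1) * W t.1 t.2.1 := mul_nonneg (hp'0 _) (hW _ _).le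
        rw [hUV, mul_comm (V _ _)]
        by_cases h0 : U t.2.2 t.1 * V t.2.2 t.2.1 = 0
        · rw [h0, zero_mul]; exact hnn
        · rw [mul_div_cancel₀ _ h0]
      refine (Finset.sum_le_sum fun t _ => h1 t).trans ?_
      rw [Fintype.sum_prod_type, Finset.sum_comm]
      have h2 : ∀ t : κ × γ, ∑ k, p' (t.2, t.1) * W k t.1 ≤ p' (t.2, t.1) := fun t => by
        rw [← Finset.mul_sum]
        exact mul_le_of_le_one_right (hp'0 _) (hWsum _)
      refine (Finset.sum_le_sum fun t _ => h2 t).trans ?_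
      rw [Fintype.sum_prod_type, Finset.sum_comm, ← Fintype.sum_prod_type', hp', sum_law, hw1]
    · have h1 := hUVpos ω hω
      have h2 : 0 < p' (G ω, K' ω) := law_pos hw (fun ω => (G ω, K' ω)) hω
      exact mul_ne_zero (hwq ω hω)
        (div_pos (mul_pos h2 (hW _ _)) (mul_pos h1.2 h1.1)).ne'
  -- Divergence of the law of (G, K') under `w` from its law under `q`.
  have G2 : 0 ≤ ∑ ω, w ω * Real.logb 2
      (p' (G ω, K' ω) / (Ub (G ω) * V (G ω) (K' ω))) := by
    refine gibbs_law hw (fun ω => (G ω, K' ω)) (q := fun t => Ub t.1 * V t.1 t.2)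
      (fun t => mul_nonneg (hUb0 _) (hV _ _)) ?_ (fun ω hω => ?_)
    · rw [hw1]
      refine le_trans (le_of_eq ?_) hqsum
      rw [Fintype.sum_prod_type, Fintype.sum_prod_type, Finset.sum_comm, Finset.sum_comm]
      rw [Finset.sum_comm' (t' := Finset.univ) (s' := fun _ => Finset.univ) (by simp)]
      simp only [hUb, Finset.sum_mul]
      rw [Finset.sum_comm' (t' := Finset.univ) (s' := fun _ => Finset.univ) (by simp)]
      rw [← Fintype.sum_prod_type' (f := fun x y => ∑ i, U x i * V x y), Finset.sum_comm]
      refine Finset.sum_congr rfl fun k _ => ?_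
      rw [Fintype.sum_prod_type, Fintype.sum_prod_type, Finset.sum_comm]
    · have h1 := hUVpos ω hω
      exact mul_ne_zero (h1.1.trans_le (hUle _ _)).ne' h1.2.ne'
  -- Divergence of the law of (K, G) under `w` from the law that keeps G and draws K from the
  -- `q`-conditional.
  have G3 : 0 ≤ ∑ ω, w ω * Real.logb 2
      (p (K ω, G ω) / (law w G (G ω) * (U (G ω) (K ω) / Ub (G ω)))) := by
    refine gibbs_law hw (fun ω => (K ω, G ω)) (q := fun t => law w G t.2 * (U t.2 t.1 / Ub t.2))
      (fun t => mul_nonneg (law_nonneg hw _ _) (div_nonneg (hU _ _) (hUb0 _))) ?_ (fun ω hω => ?_)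
    · rw [Fintype.sum_prod_type, Finset.sum_comm, ← sum_law w G]
      refine Finset.sum_le_sum fun g _ => ?_
      change ∑ k, law w G g * (U g k / Ub g) ≤ law w G g
      rw [← Finset.mul_sum, ← Finset.sum_div]
      exact mul_le_of_le_one_right (law_nonneg hw _ _) (div_self_le_one _)
    · have h1 := hUVpos ω hω
      exact mul_ne_zero (law_pos hw G hω).ne' (div_pos h1.1 (h1.1.trans_le (hUle _ _))).ne'
  -- In the sum of the three integrands all of `p'`, `U`, `V` and `Ub` cancel; what survives is
  -- log(w/q), log P(K|G) and -log W.
  have hpt : ∀ ω, w ω * Real.logb 2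
        (w ω / (q ω * (p' (G ω, K' ω) * W (K ω) (K' ω) / (V (G ω) (K' ω) * U (G ω) (K ω)))))
      + w ω * Real.logb 2 (p' (G ω, K' ω) / (Ub (G ω) * V (G ω) (K' ω)))
      + w ω * Real.logb 2 (p (K ω, G ω) / (law w G (G ω) * (U (G ω) (K ω) / Ub (G ω))))
      ≤ w ω * Real.logb 2 (w ω / q ω) + w ω * Real.logb 2 (p (K ω, G ω) / law w G (G ω)) + w ω
        + (if K ω ≠ K' ω then w ω else 0) * Real.logb 2 (Fintype.card κ) := fun ω => by
    by_cases hω : w ω = 0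
    · simp [hω]
    have h1 := hUVpos ω hω
    have h2 : p' (G ω, K' ω) ≠ 0 := (law_pos hw (fun ω => (G ω, K' ω)) hω).ne'
    have h3 : p (K ω, G ω) ≠ 0 := (law_pos hw (fun ω => (K ω, G ω)) hω).ne'
    have h4 : law w G (G ω) ≠ 0 := (law_pos hw G hω).ne'
    have h5 := hwq ω hω
    have h6 : Ub (G ω) ≠ 0 := (h1.1.trans_le (hUle _ _)).ne'
    have h7 := (hW (K ω) (K' ω)).ne'
    have h8 := h1.1.ne'
    have h9 := h1.2.ne'
    have hWlog : w ω * -Real.logb 2 (W (K ω) (K' ω)) ≤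
        w ω + (if K ω ≠ K' ω then w ω else 0) * Real.logb 2 (Fintype.card κ) := by
      simp only [hWdef]
      by_cases hk : K ω = K' ω
      · simp [hk]
      · rw [if_neg hk, if_pos hk, one_div, Real.logb_inv, neg_neg,
          Real.logb_mul two_ne_zero hc.ne', Real.logb_self_eq_one one_lt_two]
        exact le_of_eq (by ring)
    rw [Real.logb_div hω (by positivity), Real.logb_mul h5 (by positivity),
      Real.logb_div (by positivity) (by positivity), Real.logb_mul h2 h7, Real.logb_mul h9 h8,
      Real.logb_div h2 (by positivity), Real.logb_mul h6 h9, Real.logb_div h3 (by positivity),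
      Real.logb_mul h4 (by positivity), Real.logb_div h8 h6, Real.logb_div hω h5,
      Real.logb_div h3 h4]
    linarith
  have hfin := Finset.sum_le_sum fun ω (_ : ω ∈ Finset.univ) => hpt ω
  simp only [Finset.sum_add_distrib, ← Finset.sum_mul, hw1] at hfin
  linarith

end Converse

/-! ### Public discussion preserves conditional independence -/

namespace Protocol

variable {X Y Z : Type*} {n r L : ℕ} (S : Protocol X Y n r L)

/-- Alice's observations are compatible with the discussion `f`. -/
def CompatibleA (x : Fin n → X) (a : Fin S.sizeA) (f : Fin r → X) : Prop :=
  ∀ i : Fin r, S.aliceSpeaks i = true → f i = S.sendA i x a fun j => f (Fin.castLE i.2.le j)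

/-- Bob's observations are compatible with the discussion `f`. -/
def CompatibleB (y : Fin n → Y) (b : Fin S.sizeB) (f : Fin r → X) : Prop :=
  ∀ i : Fin r, S.aliceSpeaks i = false → f i = S.sendB i y b fun j => f (Fin.castLE i.2.le j)

/-- Unrolls the recursion into one local condition per symbol: once the whole of f is fixed, each
condition involves the data of a single terminal only. -/
theorem discussionUpTo_eq_iff (x : Fin n → X) (a : Fin S.sizeA) (y : Fin n → Y) (b : Fin S.sizeB)
    (f : Fin r → X) (k : ℕ) (h : k ≤ r) :
    S.discussionUpTo x a y b k h = (fun j => f (Fin.castLE h j)) ↔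
      ∀ i : Fin r, (i : ℕ) < k → f i = if S.aliceSpeaks i
        then S.sendA i x a (fun j => f (Fin.castLE i.2.le j))
        else S.sendB i y b (fun j => f (Fin.castLE i.2.le j)) := by
  induction k with
  | zero => simp [funext_iff]
  | succ k ih =>
    have hs : (fun j => f (Fin.castLE h j)) =
        Fin.snoc (α := fun _ => X) (fun j : Fin k => f (Fin.castLE (Nat.le_of_succ_le h) j))
          (f ⟨k, h⟩) := by
      funext j
      refine Fin.lastCases ?_ (fun j => ?_) j
      · rw [Fin.snoc_last]; rfl
      · rw [Fin.snoc_castSucc]; rfl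
    rw [hs, discussionUpTo, Fin.snoc_inj]
    constructor
    · rintro ⟨h1, h2⟩ i hi
      rcases Nat.lt_succ_iff_lt_or_eq.1 hi with hi | hi
      · exact (ih _).1 h1 i hi
      · have : i = ⟨k, h⟩ := Fin.ext hi
        subst this
        rw [h1] at h2
        exact h2.symm
    · intro hh
      have h1 := (ih (Nat.le_of_succ_le h)).2 fun i hi => hh i (Nat.lt_succ_of_lt hi)
      refine ⟨h1, ?_⟩
      rw [h1]
      exact (hh ⟨k, h⟩ (Nat.lt_succ_self k)).symm

/-- The rectangle property of interactive communication, from grouping the local conditions by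
speaker. -/
theorem discussion_eq_iff (ω : S.Outcome Z) (f : Fin r → X) :
    S.discussion ω = f ↔ S.CompatibleA (fun i => (ω.1 i).1) ω.2.1 f ∧
      S.CompatibleB (fun i => (ω.1 i).2.1) ω.2.2 f := by
  have h := S.discussionUpTo_eq_iff (fun i => (ω.1 i).1) ω.2.1 (fun i => (ω.1 i).2.1) ω.2.2 f r
    le_rfl
  refine (Iff.trans ?_ h).trans ?_
  · exact Iff.rfl
  · constructor
    · intro hh
      refine ⟨fun i hi => ?_, fun i hi => ?_⟩
      · simpa [hi] using hh i i.2
      · simpa [hi] using hh i i.2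
    · rintro ⟨h1, h2⟩ i -
      by_cases hi : S.aliceSpeaks i = true
      · rw [if_pos hi]; exact h1 i hi
      · rw [if_neg hi]; exact h2 i (by simpa using hi)

variable [Fintype X] [Fintype Y] [Fintype Z]

/-- The probability, given `z`, that Alice's observations are compatible with the discussion `f`
and yield the key `k`. -/
noncomputable def aliceMass (u : X → Z → ℝ) (g : (Fin n → Z) × (Fin r → X)) (k : Fin L) : ℝ :=
  open Classical in ∑ x : Fin n → X, ∑ a, if S.CompatibleA x a g.2 ∧ S.keyA x a g.2 = k
    then (∏ i, u (x i) (g.1 i)) * (S.randA a).toReal else 0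

/-- The probability, given `z`, that Bob's observations are compatible with the discussion `f`
and yield the key `k`. -/
noncomputable def bobMass (v : Y → Z → ℝ) (g : (Fin n → Z) × (Fin r → X)) (k : Fin L) : ℝ :=
  open Classical in ∑ y : Fin n → Y, ∑ b, if S.CompatibleB y b g.2 ∧ S.keyB y b g.2 = k
    then (∏ i, v (y i) (g.1 i)) * (S.randB b).toReal else 0

omit [Fintype Y] [Fintype Z] in
theorem aliceMass_nonneg {u : X → Z → ℝ} (hu : ∀ x z, 0 ≤ u x z)
    (g : (Fin n → Z) × (Fin r → X)) (k : Fin L) : 0 ≤ S.aliceMass u g k := by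
  classical
  refine Finset.sum_nonneg fun x _ => Finset.sum_nonneg fun a _ => ?_
  split_ifs
  exacts [mul_nonneg (Finset.prod_nonneg fun i _ => hu _ _) ENNReal.toReal_nonneg, le_rfl]

omit [Fintype X] [Fintype Z] in
theorem bobMass_nonneg {v : Y → Z → ℝ} (hv : ∀ y z, 0 ≤ v y z)
    (g : (Fin n → Z) × (Fin r → X)) (k : Fin L) : 0 ≤ S.bobMass v g k := by
  classical
  refine Finset.sum_nonneg fun x _ => Finset.sum_nonneg fun a _ => ?_
  split_ifs
  exacts [mul_nonneg (Finset.prod_nonneg fun i _ => hv _ _) ENNReal.toReal_nonneg, le_rfl]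

/-- If the source terminals are conditionally independent given `Z ^ n`, the keys are conditionally
independent given `Z ^ n` and the discussion. -/
theorem law_keys_observation (u : X → Z → ℝ) (v : Y → Z → ℝ)
    (t : Fin L × Fin L × ((Fin n → Z) × (Fin r → X))) :
    law (fun ω : S.Outcome Z => (∏ i, u (ω.1 i).1 (ω.1 i).2.2 * v (ω.1 i).2.1 (ω.1 i).2.2) *
        (S.randA ω.2.1).toReal * (S.randB ω.2.2).toReal)
      (fun ω => (S.key ω, S.keyHat ω, S.observation ω)) t =
      S.aliceMass u t.2.2 t.1 * S.bobMass v t.2.2 t.2.1 := by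
  classical
  obtain ⟨k, k', z, f⟩ := t
  let e : (Fin n → X × Y × Z) ≃ (Fin n → X) × (Fin n → Y) × (Fin n → Z) :=
    (Equiv.arrowProdEquivProdArrow (Fin n) (fun _ => X) (fun _ => Y × Z)).trans
      ((Equiv.refl _).prodCongr (Equiv.arrowProdEquivProdArrow (Fin n) (fun _ => Y) (fun _ => Z)))
  -- Once z and f are fixed, the event splits into a condition on (x, a) and a condition on (y, b),
  -- so its mass is a product.
  have hiff : ∀ ω : S.Outcome Z, ((S.key ω, S.keyHat ω, S.observation ω) = (k, k', z, f)) ↔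
      ((fun i => (ω.1 i).2.2) = z) ∧
      ((S.CompatibleA (fun i => (ω.1 i).1) ω.2.1 f ∧ S.keyA (fun i => (ω.1 i).1) ω.2.1 f = k) ∧
      (S.CompatibleB (fun i => (ω.1 i).2.1) ω.2.2 f ∧
        S.keyB (fun i => (ω.1 i).2.1) ω.2.2 f = k')) := fun ω => by
    have hd := S.discussion_eq_iff ω f
    simp only [Prod.mk.injEq, observation, key, keyHat]
    constructor
    · rintro ⟨h1, h2, h3, h4⟩
      rw [h4] at h1 h2
      have := hd.1 h4
      exact ⟨h3, ⟨this.1, h1⟩, this.2, h2⟩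
    · rintro ⟨h3, ⟨h5, h1⟩, h6, h2⟩
      have h4 := hd.2 ⟨h5, h6⟩
      rw [h4]
      exact ⟨h1, h2, h3, rfl⟩
  simp only [law, hiff]
  rw [Fintype.sum_prod_type, ← e.symm.sum_comp, Fintype.sum_prod_type]
  simp only [aliceMass, bobMass, Finset.sum_mul]
  refine Finset.sum_congr rfl fun x _ => ?_
  rw [Fintype.sum_prod_type]
  simp only [Finset.mul_sum]
  rw [Finset.sum_comm' (s' := fun _ => Finset.univ) (t' := Finset.univ) (by simp)]
  rw [Finset.sum_eq_single z]
  · simp only [Fintype.sum_prod_type]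
    rw [Finset.sum_comm]
    refine Finset.sum_congr rfl fun a _ => Finset.sum_congr rfl fun y _ =>
      Finset.sum_congr rfl fun b _ => ?_
    have he : ∀ i, e.symm (x, y, z) i = (x i, y i, z i) := fun i => rfl
    simp only [he, true_and]
    by_cases h1 : S.CompatibleA x a f ∧ S.keyA x a f = k
    · by_cases h2 : S.CompatibleB y b f ∧ S.keyB y b f = k'
      · rw [if_pos ⟨h1, h2⟩, if_pos h1, if_pos h2, Finset.prod_mul_distrib]
        ring
      · rw [if_neg (fun h => h2 h.2), if_neg h2, mul_zero]
    · rw [if_neg (fun h => h1 h.1), if_neg h1, zero_mul]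
  · intro z' _ hz
    refine Finset.sum_eq_zero fun y _ => Finset.sum_eq_zero fun ab _ => ?_
    exact if_neg fun h => hz h.1
  · simp

end Protocol

/-! ### The upper bound on the rate -/

section ConverseBound

variable {X Y Z : Type*} [Fintype X] [Fintype Y] [Fintype Z]

theorem mutualInfo_eq {Ω α β : Type*} [Fintype Ω] [Fintype α] [Fintype β] (w : Ω → ℝ)
    (A : Ω → α) (B : Ω → β) :
    mutualInfo w A B = ∑ ω, w ω * Real.logb 2
      (law w (fun ω => (A ω, B ω)) (A ω, B ω) / (law w A (A ω) * law w B (B ω))) := by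
  rw [mutualInfo, ← Fintype.sum_prod_type' (f := fun a b => law w (fun ω => (A ω, B ω)) (a, b) *
    Real.logb 2 (law w (fun ω => (A ω, B ω)) (a, b) / (law w A a * law w B b)))]
  exact sum_law_mul w (fun ω => (A ω, B ω))
    (fun t => Real.logb 2 (law w (fun ω => (A ω, B ω)) t / (law w A t.1 * law w B t.2)))

/-- For a Markov chain `X - Y - Z`, `I(X;Y|Z) = I(X;Y) - I(X;Z)`. -/
theorem condMutualInfo_eq (P : PMF (X × Y × Z)) (hP : IsMarkovChain P) :
    ∑ s, pXYZ P s * Real.logb 2 (pXYZ P s / (law (pXYZ P) (fun s => (s.1, s.2.2)) (s.1, s.2.2) *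
      (law (pXYZ P) (fun s => s.2) s.2 / pZ P s.2.2))) = infoXY P - infoXZ P := by
  rw [infoXY, infoXZ, mutualInfo_eq, mutualInfo_eq, ← Finset.sum_sub_distrib]
  refine Finset.sum_congr rfl fun s _ => ?_
  by_cases hs : pXYZ P s = 0
  · simp [hs]
  have h0 := pXYZ_nonneg P
  have hx := (law_pos h0 (fun s => s.1) hs).ne'
  have hy := (law_pos h0 (fun s => s.2.1) hs).ne'
  have hz := (law_pos h0 (fun s => s.2.2) hs).ne'
  have hxy := (law_pos h0 (fun s => (s.1, s.2.1)) hs).ne'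
  have hxz := (law_pos h0 (fun s => (s.1, s.2.2)) hs).ne'
  have hyz := (law_pos h0 (fun s => s.2) hs).ne'
  -- The Markov property replaces P_XYZ by P_XY P_YZ / P_Y; the conditional information density is
  -- then the difference of the two densities pointwise.
  have hm := hP s.1 s.2.1 s.2.2
  have hp : pXYZ P s = law (pXYZ P) (fun s => (s.1, s.2.1)) (s.1, s.2.1) *
      law (pXYZ P) (fun s => s.2) s.2 / law (pXYZ P) (fun s => s.2.1) s.2.1 := by
    rw [eq_div_iff hy]; exact hm
  rw [← mul_sub, ← Real.logb_div (by positivity) (by positivity)]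
  congr 2
  rw [pZ]
  conv_lhs => rw [hp]
  field_simp

/-- Every protocol: the key rate is bounded by `n I(X;Y|Z)` up to the error, uniformity and
non-confusion defects. -/
theorem Protocol.log_key_size_le {n r L : ℕ} (hL : 0 < L) (S : Protocol X Y n r L)
    (P : PMF (X × Y × Z)) (hP : IsMarkovChain P) {ε : ℝ} (h1 : S.errorProb P ≤ ε)
    (h2 : Real.logb 2 L - entropy (S.keyLaw P) ≤ ε) (h3 : S.nonConfusion P ≤ (ε : EReal)) :
    Real.logb 2 L ≤ n * (infoXY P - infoXZ P) + 1 + ε * Real.logb 2 L + 2 * ε := by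
  classical
  have : Nonempty (Fin L) := ⟨⟨0, hL⟩⟩
  -- `u` is P_XZ and `v` is P_{Y|Z}: their product is the single-letter law with X and Y
  -- conditionally independent given Z.
  set u : X → Z → ℝ := fun x z => law (pXYZ P) (fun s => (s.1, s.2.2)) (x, z) with hu
  set v : Y → Z → ℝ := fun y z => law (pXYZ P) (fun s => s.2) (y, z) / pZ P z with hv
  have h0 := pXYZ_nonneg P
  have hu0 : ∀ x z, 0 ≤ u x z := fun x z => law_nonneg h0 _ _
  have hz0 : ∀ z, 0 ≤ pZ P z := fun z => law_nonneg h0 _ _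
  have hv0 : ∀ y z, 0 ≤ v y z := fun x z => div_nonneg (law_nonneg h0 _ _) (hz0 _)
  have hupos : ∀ s, pXYZ P s ≠ 0 → 0 < u s.1 s.2.2 := fun s hs =>
    law_pos h0 (fun s => (s.1, s.2.2)) hs
  have hvpos : ∀ s, pXYZ P s ≠ 0 → 0 < v s.2.1 s.2.2 := fun s hs =>
    div_pos (law_pos h0 (fun s => s.2) hs) (law_pos h0 (fun s => s.2.2) hs)
  set w := S.weight P with hwdef
  have hw := S.weight_nonneg P
  have hw1 := S.sum_weight P
  set q : S.Outcome Z → ℝ := fun ω =>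
    (∏ i, u (ω.1 i).1 (ω.1 i).2.2 * v (ω.1 i).2.1 (ω.1 i).2.2) *
        (S.randA ω.2.1).toReal * (S.randB ω.2.2).toReal with hq
  have hwne : ∀ ω, w ω ≠ 0 → (∀ i, pXYZ P (ω.1 i) ≠ 0) ∧ (S.randA ω.2.1).toReal ≠ 0 ∧
      (S.randB ω.2.2).toReal ≠ 0 := fun ω hω => by
    have ha := left_ne_zero_of_mul hω
    exact ⟨fun i => Finset.prod_ne_zero_iff.1 (left_ne_zero_of_mul ha) i (Finset.mem_univ i),
      right_ne_zero_of_mul ha, right_ne_zero_of_mul hω⟩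
  have hq0 : ∀ ω, 0 ≤ q ω := fun ω =>
    mul_nonneg (mul_nonneg (Finset.prod_nonneg fun i _ => mul_nonneg (hu0 _ _) (hv0 _ _))
      ENNReal.toReal_nonneg) ENNReal.toReal_nonneg
  have hwq : ∀ ω, w ω ≠ 0 → q ω ≠ 0 := fun ω hω => by
    obtain ⟨hp, ha, hb⟩ := hwne ω hω
    exact mul_ne_zero (mul_ne_zero (Finset.prod_ne_zero_iff.2 fun i _ =>
      (mul_pos (hupos _ (hp i)) (hvpos _ (hp i))).ne') ha) hb
  have huv : ∑ s : X × Y × Z, u s.1 s.2.2 * v s.2.1 s.2.2 ≤ 1 := by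
    calc ∑ s : X × Y × Z, u s.1 s.2.2 * v s.2.1 s.2.2
        = ∑ z, ∑ x, ∑ y, u x z * v y z := by
          simp only [Fintype.sum_prod_type]
          rw [Finset.sum_comm]
          refine Eq.trans (Finset.sum_congr rfl fun y _ => Finset.sum_comm) ?_
          rw [Finset.sum_comm]
          exact Finset.sum_congr rfl fun y _ => Finset.sum_comm
      _ = ∑ z, pZ P z * (pZ P z / pZ P z) := by
          refine Finset.sum_congr rfl fun z _ => ?_
          rw [← Finset.sum_mul_sum, hu, hv]
          simp only [← Finset.sum_div]
          rw [sum_law_pair_left (pXYZ P) (fun s => s.1) (fun s => s.2.2),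
            sum_law_pair_left (pXYZ P) (fun s => s.2.1) (fun s => s.2.2)]
          rfl
      _ ≤ ∑ z, pZ P z :=
          Finset.sum_le_sum fun z _ => mul_le_of_le_one_right (hz0 z) (div_self_le_one _)
      _ = 1 := by rw [← sum_pXYZ P]; exact sum_law _ _
  have hq1 : ∑ ω, q ω ≤ 1 := by
    rw [hq, S.sum_randomness (fun s => ∏ i, u (s i).1 (s i).2.2 * v (s i).2.1 (s i).2.2),
      sum_prod_eq_pow n (fun s : X × Y × Z => u s.1 s.2.2 * v s.2.1 s.2.2)]
    exact pow_le_one₀ (Finset.sum_nonneg fun s _ => mul_nonneg (hu0 _ _) (hv0 _ _)) huv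
  have hdiv : ∑ ω, w ω * Real.logb 2 (w ω / q ω) = n * (infoXY P - infoXZ P) := by
    rw [← condMutualInfo_eq P hP, ← sum_iid_mul_sum n (sum_pXYZ P), ← S.sum_weight_mul P
      (fun s => ∑ i, Real.logb 2 (pXYZ P (s i) / (law (pXYZ P) (fun s => (s.1, s.2.2))
        ((s i).1, (s i).2.2) * (law (pXYZ P) (fun s => s.2) (s i).2 / pZ P (s i).2.2))))]
    refine Finset.sum_congr rfl fun ω _ => ?_
    by_cases hω : w ω = 0
    · rw [hω, ← hwdef, hω, zero_mul, zero_mul]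
    obtain ⟨hp, ha, hb⟩ := hwne ω hω
    rw [← Real.logb_prod]
    · congr 2
      rw [Finset.prod_div_distrib, hwdef, Protocol.weight, hq]
      simp only
      rw [mul_div_mul_right _ _ hb, mul_div_mul_right _ _ ha]
    · intro i _
      exact (div_pos ((h0 _).lt_of_ne (hp i).symm)
        (mul_pos (hupos _ (hp i)) (hvpos _ (hp i)))).ne'
  have key := condEntropy_le hw hq0 hw1 hq1 hwq S.key S.keyHat S.observation
    (S.aliceMass u) (S.bobMass v) (S.aliceMass_nonneg hu0) (S.bobMass_nonneg hv0)
    (S.law_keys_observation u v)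
  rw [hdiv, Fintype.card_fin] at key
  have hne : ∀ ω, w ω ≠ 0 →
      S.keyLaw P (S.key ω) * S.observationLaw P (S.observation ω) ≠ 0 := fun ω hω =>
    mul_ne_zero (law_pos hw S.key hω).ne' (law_pos hw S.observation hω).ne'
  rw [nonConfusion, jointLaw, divergence_law _ hne, EReal.coe_le_coe_iff] at h3
  rw [keyLaw, entropy_law] at h2
  -- The chain rule -H(K|G) = I(K;G) - H(K), outcome by outcome.
  have hsplit : ∀ ω, w ω * Real.logb 2 (law w (fun ω => (S.key ω, S.observation ω))
        (S.key ω, S.observation ω) / law w S.observation (S.observation ω)) =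
      w ω * Real.logb 2 (law w (fun ω => (S.key ω, S.observation ω)) (S.key ω, S.observation ω) /
        (S.keyLaw P (S.key ω) * S.observationLaw P (S.observation ω))) +
      w ω * Real.logb 2 (law w S.key (S.key ω)) := fun ω => by
    by_cases hω : w ω = 0
    · simp [hω]
    have e1 := (law_pos hw S.key hω).ne'
    have e2 := (law_pos hw S.observation hω).ne'
    have e3 := (law_pos hw (fun ω => (S.key ω, S.observation ω)) hω).ne'
    rw [keyLaw, observationLaw, Real.logb_div e3 e2, Real.logb_div e3 (mul_ne_zero e1 e2),
      Real.logb_mul e1 e2]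
    ring
  rw [Finset.sum_congr rfl fun ω _ => hsplit ω, Finset.sum_add_distrib] at key
  have hL0 : 0 ≤ Real.logb 2 L := Real.logb_nonneg one_lt_two (by exact_mod_cast hL)
  have herr := mul_le_mul_of_nonneg_right h1 hL0
  rw [errorProb] at herr
  have h2' : Real.logb 2 L - -∑ ω, w ω * Real.logb 2 (law w S.key (S.key ω)) ≤ ε := h2
  have h3' : ∑ ω, w ω * Real.logb 2
      (law w (fun ω => (S.key ω, S.observation ω)) (S.key ω, S.observation ω) /
        (S.keyLaw P (S.key ω) * S.observationLaw P (S.observation ω))) ≤ ε := h3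
  linarith

theorem Achievable.le {P : PMF (X × Y × Z)} (hP : IsMarkovChain P) {R : ℝ}
    (hR : Achievable P R) : R ≤ infoXY P - infoXZ P := by
  obtain ⟨hR0, hR⟩ := hR
  -- Dividing by n removes the additive terms for fixed ε; the factor 1 - ε, left by the Fano term,
  -- goes away only afterwards as ε tends to 0.
  have step : ∀ ε : ℝ, 0 < ε → ε < 1 → (1 - ε) * R ≤ infoXY P - infoXZ P := by
    intro ε h0 h1
    have hev : ∀ᶠ n : ℕ in Filter.atTop,
        (1 - ε) * R ≤ (infoXY P - infoXZ P) + (1 + 2 * ε) * (1 / (n : ℝ)) := by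
      filter_upwards [hR ε h0, Filter.eventually_gt_atTop 0] with n ⟨r, S, e1, e2, e3⟩ hn
      have hpos : (0 : ℝ) < 2 ^ ((n : ℝ) * R) := Real.rpow_pos_of_pos two_pos _
      have hL : 0 < ⌈(2 : ℝ) ^ ((n : ℝ) * R)⌉₊ := Nat.ceil_pos.2 hpos
      have hb := S.log_key_size_le hL P hP e1 e2 e3
      have hlog : (n : ℝ) * R ≤ Real.logb 2 (⌈(2 : ℝ) ^ ((n : ℝ) * R)⌉₊ : ℝ) := by
        rw [Real.le_logb_iff_rpow_le one_lt_two (by exact_mod_cast hL)]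
        exact Nat.le_ceil _
      have hn' : (0 : ℝ) < n := by exact_mod_cast hn
      have := mul_le_mul_of_nonneg_left hlog (sub_nonneg.2 h1.le)
      have h3 : n * ((1 - ε) * R) ≤ n * ((infoXY P - infoXZ P) + (1 + 2 * ε) * (1 / (n : ℝ))) := by
        have : (n : ℝ) * ((1 + 2 * ε) * (1 / (n : ℝ))) = 1 + 2 * ε := by field_simp
        rw [mul_add, this]
        linarith
      exact le_of_mul_le_mul_left h3 hn'
    refine ge_of_tendsto ?_ hev
    have h := (tendsto_one_div_atTop_nhds_zero_nat (𝕜 := ℝ)).const_mul (1 + 2 * ε)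
    simpa using h.const_add (infoXY P - infoXZ P)
  have hlim : Filter.Tendsto (fun ε : ℝ => (1 - ε) * R) (nhdsWithin 0 (Set.Ioi 0)) (nhds R) := by
    have h : Continuous fun ε : ℝ => (1 - ε) * R := by fun_prop
    simpa using (h.tendsto 0).mono_left nhdsWithin_le_nhds
  refine le_of_tendsto hlim ?_
  filter_upwards [Ioo_mem_nhdsGT (zero_lt_one (α := ℝ))] with ε hε
  exact step ε hε.1 hε.2

theorem meaninglessLaw_nonneg (P : PMF (X × Y × Z)) (n r : ℕ)
    (t : (Fin n → Z) × (Fin r → X)) : 0 ≤ meaninglessLaw P n r t :=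
  mul_nonneg (Finset.prod_nonneg fun _ _ => law_nonneg (pXYZ_nonneg P) _ _)
    (Finset.prod_nonneg fun _ _ => by positivity)

theorem sum_meaninglessLaw_le (P : PMF (X × Y × Z)) (n r : ℕ) :
    ∑ t, meaninglessLaw (X := X) P n r t ≤ 1 := by
  simp only [meaninglessLaw]
  rw [Fintype.sum_prod_type]
  simp only
  rw [← Finset.sum_mul_sum, sum_prod_eq_pow n (pZ P),
    sum_prod_eq_pow r (fun _ : X => 1 / (Fintype.card X : ℝ))]
  have h1 : ∑ z, pZ P z = 1 := by rw [← sum_pXYZ P]; exact sum_law _ _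
  rw [h1, one_pow, one_mul]
  refine pow_le_one₀ (Finset.sum_nonneg fun _ _ => by positivity) ?_
  simp [mul_inv_le_one]

theorem Protocol.nonStealth_nonneg {n r L : ℕ} (S : Protocol X Y n r L) (P : PMF (X × Y × Z)) :
    0 ≤ S.nonStealth P := by
  refine divergence_nonneg (law_nonneg (S.weight_nonneg P) _) (meaninglessLaw_nonneg P n r) ?_
  rw [observationLaw, sum_law, S.sum_weight]
  exact sum_meaninglessLaw_le P n r

theorem StealthyAchievable.achievable {P : PMF (X × Y × Z)} {R : ℝ}
    (h : StealthyAchievable P R) : Achievable P R := by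
  refine ⟨h.1, fun ε hε => ?_⟩
  filter_upwards [h.2 ε hε] with n ⟨r, S, e1, e2, e3⟩
  refine ⟨r, S, e1, e2, le_trans (le_add_of_nonneg_right (S.nonStealth_nonneg P)) e3⟩

end ConverseBound

/-! ### Random binning -/

section Binning

variable {A B : Type*} [Fintype A] [DecidableEq A] [Fintype B]

/-- The value of a uniformly random function at `a` is uniform and independent of its value at
`a' ≠ a`. -/
theorem sum_functions_resample {a a' : A} (h : a' ≠ a) (ψ : B → B → ℝ) :
    (Fintype.card B : ℝ) * ∑ f : A → B, ψ (f a) (f a') = ∑ f : A → B, ∑ b, ψ b (f a') := by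
  let e := Equiv.piSplitAt a (fun _ : A => B)
  rw [← e.symm.sum_comp, ← e.symm.sum_comp, Fintype.sum_prod_type, Fintype.sum_prod_type]
  have h1 : ∀ b g, e.symm (b, g) a = b := fun b g => by simp [e, Equiv.piSplitAt]
  have h2 : ∀ b g, e.symm (b, g) a' = g ⟨a', h⟩ := fun b g => by
    simp [e, Equiv.piSplitAt, h]
  simp only [h1, h2]
  rw [Finset.sum_const, Finset.card_univ, nsmul_eq_mul, Finset.sum_comm]

/-- Universality of random hashing: distinct points collide with probability 1/|B|, equal points
always. The bound covers both cases at once. -/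
theorem card_mul_collisions_le [DecidableEq B] (a a' : A) :
    (Fintype.card B : ℝ) * ∑ f : A → B, (if f a' = f a then 1 else 0) ≤
      Fintype.card (A → B) * (Fintype.card B * (if a' = a then 1 else 0) + 1) := by
  by_cases h : a' = a
  · subst h
    simp only [if_true, Finset.sum_const, Finset.card_univ, nsmul_eq_mul, mul_one]
    rw [mul_add, mul_one, mul_comm]
    exact le_add_of_nonneg_right (Nat.cast_nonneg _)
  · rw [sum_functions_resample h (fun b b' => if b' = b then 1 else 0)]
    simp [h]

theorem card_mul_collisions_snd {K F : Type*} [Fintype K] [Fintype F] [DecidableEq F] [Nonempty K]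
    {a a' : A} (h : a' ≠ a) :
    (Fintype.card F : ℝ) * ∑ f : A → K × F, (if (f a').2 = (f a).2 then 1 else 0) =
      Fintype.card (A → K × F) := by
  have h1 := sum_functions_resample (B := K × F) h
    (fun b b' => if b'.2 = b.2 then (1 : ℝ) else 0)
  have h2 : ∀ f : A → K × F, ∑ b : K × F, (if (f a').2 = b.2 then (1 : ℝ) else 0) =
      Fintype.card K := fun f => by
    rw [Fintype.sum_prod_type]
    simp
  simp only [h2, Finset.sum_const, Finset.card_univ, nsmul_eq_mul] at h1
  rw [Fintype.card_prod, Nat.cast_mul, mul_assoc, mul_comm] at h1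
  exact mul_right_cancel₀ (Nat.cast_ne_zero.2 Fintype.card_ne_zero) h1

/-- Trades the logarithm for a power, which factors over i.i.d. coordinates. It combines (1+t)^s ≤ 1
+ t^s with log(1+x) ≤ x. -/
theorem logb_one_add_le {t s : ℝ} (ht : 0 ≤ t) (hs : 0 < s) (hs1 : s ≤ 1) :
    Real.logb 2 (1 + t) ≤ t ^ s / (s * Real.log 2) := by
  have hl : 0 < Real.log 2 := Real.log_pos one_lt_two
  rw [Real.logb, ← div_div]
  refine div_le_div_of_nonneg_right ?_ hl.le
  rw [le_div_iff₀ hs, mul_comm, ← Real.log_rpow (by linarith)]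
  have h1 : (1 + t) ^ s ≤ 1 + t ^ s := by
    simpa using Real.rpow_add_le_add_rpow zero_le_one ht hs.le hs1
  have h2 : 0 ≤ t ^ s := Real.rpow_nonneg ht s
  refine (Real.log_le_log (Real.rpow_pos_of_pos (by linarith) _) h1).trans ?_
  have := Real.log_le_sub_one_of_pos (show 0 < 1 + t ^ s by linarith)
  linarith

variable {Ω β γ κ φ : Type*} [Fintype Ω] [Fintype β] [Fintype γ] [Fintype κ] [Fintype φ]

/-- The conditional probability `P_{A|C}(A(ω)|C(ω))`. -/
noncomputable def condProb {Ω A γ : Type*} [Fintype Ω] (w : Ω → ℝ) (f : Ω → A) (g : Ω → γ)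
    (ω : Ω) : ℝ :=
  law w (fun ω => (f ω, g ω)) (f ω, g ω) / law w g (g ω)

omit [Fintype A] [DecidableEq A] [Fintype γ] in
theorem condProb_nonneg {w : Ω → ℝ} (hw : ∀ ω, 0 ≤ w ω) (f : Ω → A) (g : Ω → γ) (ω : Ω) :
    0 ≤ condProb w f g ω :=
  div_nonneg (law_nonneg hw _ _) (law_nonneg hw _ _)

omit [Fintype A] [DecidableEq A] [Fintype γ] in
theorem condProb_pos {w : Ω → ℝ} (hw : ∀ ω, 0 ≤ w ω) (f : Ω → A) (g : Ω → γ) {ω : Ω}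
    (h : w ω ≠ 0) : 0 < condProb w f g ω :=
  div_pos (law_pos hw (fun ω => (f ω, g ω)) h) (law_pos hw g h)

omit [DecidableEq A] [Fintype γ] in
theorem condProb_le_one {w : Ω → ℝ} (hw : ∀ ω, 0 ≤ w ω) (f : Ω → A) (g : Ω → γ) (ω : Ω) :
    condProb w f g ω ≤ 1 := by
  refine div_le_one_of_le₀ ?_ (law_nonneg hw _ _)
  rw [← sum_law_pair_left w f g]
  exact Finset.single_le_sum (f := fun b => law w (fun ω => (f ω, g ω)) (b, g ω))
    (fun b _ => law_nonneg hw _ _) (Finset.mem_univ _)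

omit [Fintype γ] in
/-- Privacy amplification by a random function, on average over the function. -/
theorem sum_divergence_binning_le [Nonempty B] {w : Ω → ℝ} (hw : ∀ ω, 0 ≤ w ω)
    (f : Ω → A) (g : Ω → γ) :
    ∑ h : A → B, ∑ ω, w ω * Real.logb 2
        (Fintype.card B * law w (fun ω => (h (f ω), g ω)) (h (f ω), g ω) / law w g (g ω)) ≤
      Fintype.card (A → B) * ∑ ω, w ω * Real.logb 2 (1 + Fintype.card B * condProb w f g ω) := by
  classical
  have hB : (0 : ℝ) < Fintype.card B := by exact_mod_cast Fintype.card_pos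
  rw [Finset.sum_comm, Finset.mul_sum]
  refine Finset.sum_le_sum fun ω _ => ?_
  by_cases hω : w ω = 0
  · simp [hω]
  rw [← Finset.mul_sum, mul_left_comm]
  refine mul_le_mul_of_nonneg_left ?_ (hw ω)
  have hg := law_pos hw g hω
  set c : ℝ := 1 + Fintype.card B * condProb w f g ω with hc
  have hc0 : 0 < c := by
    have := condProb_nonneg hw f g ω
    positivity
  set u : (A → B) → ℝ := fun h =>
    Fintype.card B * law w (fun ω => (h (f ω), g ω)) (h (f ω), g ω) / law w g (g ω) with hu
  have hu0 : ∀ h, 0 < u h := fun h =>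
    div_pos (mul_pos hB (law_pos hw (fun ω => (h (f ω), g ω)) hω)) hg
  -- The mean of `u` over the random function is at most `c`: outcomes with the same `f ω`
  -- contribute |B| times the conditional probability, all others at most 1 in total.
  have hsum : ∑ h, u h ≤ Fintype.card (A → B) * c := by
    have h1 : ∀ h : A → B, Fintype.card B * law w (fun ω => (h (f ω), g ω)) (h (f ω), g ω) =
        ∑ ω', (if g ω' = g ω then w ω' else 0) *
          (Fintype.card B * if h (f ω') = h (f ω) then 1 else 0) := fun h => by
      rw [law, Finset.mul_sum]
      refine Finset.sum_congr rfl fun ω' _ => ?_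
      simp only [Prod.mk.injEq]
      by_cases e1 : h (f ω') = h (f ω) <;> by_cases e2 : g ω' = g ω <;> simp [e1, e2, mul_comm]
    have h2 : c = (∑ ω', (if g ω' = g ω then w ω' else 0) *
        (Fintype.card B * (if f ω' = f ω then 1 else 0) + 1)) / law w g (g ω) := by
      rw [eq_div_iff hg.ne', hc, condProb, add_mul, mul_assoc, div_mul_cancel₀ _ hg.ne', one_mul]
      simp only [mul_add, mul_one, Finset.sum_add_distrib]
      rw [add_comm]
      congr 1
      · rw [law, Finset.mul_sum]
        refine Finset.sum_congr rfl fun ω' _ => ?_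
        simp only [Prod.mk.injEq]
        by_cases e1 : f ω' = f ω <;> by_cases e2 : g ω' = g ω <;> simp [e1, e2, mul_comm]
    rw [h2, hu, ← Finset.sum_div, ← mul_div_assoc]
    refine div_le_div_of_nonneg_right ?_ hg.le
    simp only [h1]
    rw [Finset.sum_comm, Finset.mul_sum]
    refine Finset.sum_le_sum fun ω' _ => ?_
    rw [← Finset.mul_sum, mul_left_comm, ← Finset.mul_sum]
    refine mul_le_mul_of_nonneg_left (card_mul_collisions_le _ _) ?_
    split_ifs
    exacts [hw ω', le_rfl]
  have hl : 0 < Real.log 2 := Real.log_pos one_lt_two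
  -- The tangent of the logarithm at `c`; averaging it over `h` is Jensen's inequality.
  have hlog : ∀ h, Real.logb 2 (u h) ≤ Real.logb 2 c + (u h / c - 1) / Real.log 2 := fun h => by
    have h1 := Real.log_le_sub_one_of_pos (div_pos (hu0 h) hc0)
    rw [Real.log_div (hu0 h).ne' hc0.ne'] at h1
    rw [Real.logb, Real.logb, ← add_div]
    exact div_le_div_of_nonneg_right (by linarith) hl.le
  refine (Finset.sum_le_sum fun h _ => hlog h).trans ?_
  rw [Finset.sum_add_distrib, ← Finset.sum_div, Finset.sum_sub_distrib, ← Finset.sum_div]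
  simp only [Finset.sum_const, Finset.card_univ, nsmul_eq_mul, mul_one]
  have h3 : (∑ h, u h) / c ≤ Fintype.card (A → B) := by rwa [div_le_iff₀ hc0]
  have h4 : ((∑ h, u h) / c - Fintype.card (A → B)) / Real.log 2 ≤ 0 :=
    div_nonpos_of_nonpos_of_nonneg (by linarith) hl.le
  linarith

omit [DecidableEq A] in
/-- Maximum-likelihood decoding of `a` from `b` and the bin index of `a`. -/
theorem exists_decoder {β φ : Type*} [Nonempty A] (p : A × β → ℝ) (f : A → φ) :
    ∃ d : β → φ → A, ∀ b a, d b (f a) ≠ a → ∃ a', a' ≠ a ∧ f a' = f a ∧ p (a, b) ≤ p (a', b) := by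
  classical
  have h : ∀ (b : β) (i : φ), ∃ a₀, ∀ a, f a = i → f a₀ = i ∧ p (a, b) ≤ p (a₀, b) := fun b i => by
    by_cases hne : (Finset.univ.filter fun a => f a = i).Nonempty
    · obtain ⟨a₀, h1, h2⟩ := Finset.exists_max_image _ (fun a => p (a, b)) hne
      exact ⟨a₀, fun a ha => ⟨(Finset.mem_filter.1 h1).2, h2 a (by simp [ha])⟩⟩
    -- An empty bin is never the bin of any `a`, so the decoder's value there is irrelevant.
    · exact ⟨Classical.arbitrary A, fun a ha => absurd ⟨a, by simp [ha]⟩ hne⟩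
  choose d hd using h
  exact ⟨d, fun b a hne => ⟨d b (f a), hne, hd b (f a) a rfl⟩⟩

omit [Fintype β] in
/-- Slepian-Wolf decoding with random bins, on average over the binning. -/
theorem sum_error_binning_le [Nonempty κ] [Nonempty φ] {w : Ω → ℝ} (hw : ∀ ω, 0 ≤ w ω)
    (f : Ω → A) (g : Ω → β) (d : (A → κ × φ) → β → φ → A)
    (hd : ∀ h b a, d h b (h a).2 ≠ a → ∃ a', a' ≠ a ∧ (h a').2 = (h a).2 ∧
      law w (fun ω => (f ω, g ω)) (a, b) ≤ law w (fun ω => (f ω, g ω)) (a', b))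
    {s : ℝ} (hs : 0 < s) (hs1 : s ≤ 1) :
    ∑ h : A → κ × φ, ∑ ω, (if d h (g ω) (h (f ω)).2 ≠ f ω then w ω else 0) ≤
      Fintype.card (A → κ × φ) * ∑ ω, w ω * (1 / (Fintype.card φ * condProb w f g ω)) ^ s := by
  classical
  have hF : (0 : ℝ) < Fintype.card φ := by exact_mod_cast Fintype.card_pos
  rw [Finset.sum_comm, Finset.mul_sum]
  refine Finset.sum_le_sum fun ω _ => ?_
  by_cases hω : w ω = 0
  · simp [hω]
  have h1 : ∑ h : A → κ × φ, (if d h (g ω) (h (f ω)).2 ≠ f ω then w ω else 0) =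
      w ω * ∑ h : A → κ × φ, (if d h (g ω) (h (f ω)).2 ≠ f ω then 1 else 0) := by
    rw [Finset.mul_sum]
    exact Finset.sum_congr rfl fun h _ => by simp
  rw [h1, mul_left_comm]
  refine mul_le_mul_of_nonneg_left ?_ (hw ω)
  have hcp := condProb_pos hw f g hω
  set v : ℝ := Fintype.card φ * condProb w f g ω with hv
  have hv0 : 0 < v := mul_pos hF hcp
  have hH : (0 : ℝ) ≤ Fintype.card (A → κ × φ) := Nat.cast_nonneg _
  -- The error probability is at most min(1, 1/v), and this is at most (1/v)^s for 0 < s ≤ 1.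
  by_cases hv1 : v ≤ 1
  · have h2 : (1 : ℝ) ≤ (1 / v) ^ s :=
      Real.one_le_rpow ((one_le_div hv0).2 hv1) hs.le
    calc ∑ h : A → κ × φ, (if d h (g ω) (h (f ω)).2 ≠ f ω then (1 : ℝ) else 0)
        ≤ ∑ h : A → κ × φ, 1 := Finset.sum_le_sum fun h _ => by split_ifs <;> norm_num
      _ = Fintype.card (A → κ × φ) := by simp
      _ ≤ _ := le_mul_of_one_le_right hH h2
  · have hv1 := not_le.1 hv1
    have h2 : 1 / v ≤ (1 / v) ^ s := by
      have h3 : 1 / v ≤ 1 := (div_le_one hv0).2 hv1.le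
      simpa using Real.rpow_le_rpow_of_exponent_ge (by positivity) h3 hs1
    refine le_trans ?_ (mul_le_mul_of_nonneg_left h2 hH)
    set p := law w (fun ω => (f ω, g ω)) with hp
    -- The competitors of the true value: an error forces one of them into its bin.
    set T : Finset A := Finset.univ.filter fun a' => a' ≠ f ω ∧ p (f ω, g ω) ≤ p (a', g ω) with hT
    have h3 : ∀ h : A → κ × φ, (if d h (g ω) (h (f ω)).2 ≠ f ω then (1 : ℝ) else 0) ≤
        ∑ a' ∈ T, if (h a').2 = (h (f ω)).2 then (1 : ℝ) else 0 := fun h => by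
      have hnn : ∀ a' ∈ T, (0 : ℝ) ≤ if (h a').2 = (h (f ω)).2 then (1 : ℝ) else 0 :=
        fun a' _ => by split_ifs <;> norm_num
      split_ifs with hne
      · obtain ⟨a', e1, e2, e3⟩ := hd h _ _ hne
        have hm : a' ∈ T := by simp [hT, e1, e3]
        refine le_trans ?_ (Finset.single_le_sum hnn hm)
        simp [e2]
      · exact Finset.sum_nonneg hnn
    -- Competitors are at least as likely as the truth, so at most 1/P(a|b) of them fit into total
    -- mass one.
    have h4 : (T.card : ℝ) * condProb w f g ω ≤ 1 := by
      rw [condProb, ← mul_div_assoc]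
      refine div_le_one_of_le₀ ?_ (law_nonneg hw _ _)
      rw [← sum_law_pair_left w f g, ← nsmul_eq_mul, ← Finset.sum_const]
      refine (Finset.sum_le_sum fun a' ha' => (Finset.mem_filter.1 ha').2.2).trans ?_
      exact Finset.sum_le_univ_sum_of_nonneg fun a' => law_nonneg hw _ _
    have h5 : ∀ a' ∈ T, ∑ h : A → κ × φ, (if (h a').2 = (h (f ω)).2 then (1 : ℝ) else 0) =
        Fintype.card (A → κ × φ) / Fintype.card φ := fun a' ha' => by
      rw [eq_div_iff hF.ne', mul_comm]
      exact card_mul_collisions_snd (Finset.mem_filter.1 ha').2.1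
    refine (Finset.sum_le_sum fun h _ => h3 h).trans ?_
    rw [Finset.sum_comm, Finset.sum_congr rfl h5, Finset.sum_const, nsmul_eq_mul]
    rw [mul_one_div, le_div_iff₀ hv0, hv]
    calc (T.card : ℝ) * (Fintype.card (A → κ × φ) / Fintype.card φ) *
          (Fintype.card φ * condProb w f g ω)
        = Fintype.card (A → κ × φ) * (T.card * condProb w f g ω) := by field_simp
      _ ≤ Fintype.card (A → κ × φ) := mul_le_of_le_one_right hH h4

omit [Fintype β] [Fintype γ] in
/-- There is a binning that is good both for decoding from `g` and for secrecy from `g'`. -/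
theorem exists_binning [Nonempty A] [Nonempty κ] [Nonempty φ] {w : Ω → ℝ}
    (hw : ∀ ω, 0 ≤ w ω) (f : Ω → A) (g : Ω → β) (g' : Ω → γ) {s t : ℝ} (hs : 0 < s) (hs1 : s ≤ 1)
    (ht : 0 < t) (ht1 : t ≤ 1) :
    ∃ (h : A → κ × φ) (d : β → φ → A),
      ∑ ω, (if d (g ω) (h (f ω)).2 ≠ f ω then w ω else 0) +
        ∑ ω, w ω * Real.logb 2 (Fintype.card (κ × φ) *
          law w (fun ω => (h (f ω), g' ω)) (h (f ω), g' ω) / law w g' (g' ω)) ≤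
      ∑ ω, w ω * (1 / (Fintype.card φ * condProb w f g ω)) ^ s +
        (∑ ω, w ω * (Fintype.card (κ × φ) * condProb w f g' ω) ^ t) / (t * Real.log 2) := by
  have hex := fun h : A → κ × φ =>
    exists_decoder (law w (fun ω => (f ω, g ω))) (fun a => (h a).2)
  choose d hd using hex
  have h1 := sum_error_binning_le hw f g d hd hs hs1
  have h2 := sum_divergence_binning_le (B := κ × φ) hw f g'
  have h3 : ∑ ω, w ω * Real.logb 2 (1 + Fintype.card (κ × φ) * condProb w f g' ω) ≤
      (∑ ω, w ω * (Fintype.card (κ × φ) * condProb w f g' ω) ^ t) / (t * Real.log 2) := by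
    rw [Finset.sum_div]
    refine Finset.sum_le_sum fun ω _ => ?_
    rw [mul_div_assoc]
    exact mul_le_mul_of_nonneg_left (logb_one_add_le
      (mul_nonneg (Nat.cast_nonneg _) (condProb_nonneg hw _ _ _)) ht ht1) (hw ω)
  have h4 := h2.trans (mul_le_mul_of_nonneg_left h3 (Nat.cast_nonneg (Fintype.card (A → κ × φ))))
  have h5 := add_le_add h1 h4
  rw [← Finset.sum_add_distrib, ← mul_add] at h5
  -- If every binning exceeded the bound, so would the average.
  by_contra! hcon
  have h6 := Finset.sum_lt_sum_of_nonempty (s := Finset.univ) Finset.univ_nonempty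
    fun h _ => hcon h (d h)
  rw [Finset.sum_const, Finset.card_univ, nsmul_eq_mul] at h6
  exact absurd h5 (not_le.2 h6)

end Binning

/-! ### Exponents from fractional moments -/

/-- A negative mean exponent yields a moment below one. -/
theorem exists_moment_lt_one {S : Type*} [Fintype S] {p g : S → ℝ} (hp : ∑ s, p s = 1)
    (hg : ∀ s, p s ≠ 0 → 0 < g s) (h : ∑ s, p s * Real.logb 2 (g s) < 0) :
    ∃ t : ℝ, 0 < t ∧ t ≤ 1 ∧ ∑ s, p s * g s ^ t < 1 := by
  have hlog : ∑ s, p s * Real.log (g s) < 0 := by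
    have h1 : ∑ s, p s * Real.logb 2 (g s) = (∑ s, p s * Real.log (g s)) / Real.log 2 := by
      rw [Finset.sum_div]
      exact Finset.sum_congr rfl fun s _ => by rw [Real.logb, mul_div_assoc]
    rw [h1, div_lt_iff₀ (Real.log_pos one_lt_two), zero_mul] at h
    exact h
  -- The exponential form is differentiable at 0 whatever the sign of `g s`, and agrees with the
  -- power wherever `p s ≠ 0`. F(0) = 1 and F'(0) is the mean logarithm, hence negative.
  set F : ℝ → ℝ := fun t => ∑ s, p s * Real.exp (Real.log (g s) * t) with hF
  have hd : HasDerivAt F (∑ s, p s * Real.log (g s)) 0 := by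
    refine HasDerivAt.fun_sum fun s _ => ?_
    have h1 : HasDerivAt (fun t : ℝ => Real.exp (Real.log (g s) * t)) (Real.log (g s)) 0 := by
      have := ((hasDerivAt_id (0 : ℝ)).const_mul (Real.log (g s))).exp
      simpa using this
    exact h1.const_mul (p s)
  have hF0 : F 0 = 1 := by simp [hF, hp]
  have hs := (hasDerivAt_iff_tendsto_slope.1 hd).eventually (gt_mem_nhds hlog)
  have hs' : ∀ᶠ t in nhdsWithin (0 : ℝ) (Set.Ioi 0), slope F 0 t < 0 :=
    hs.filter_mono (nhdsWithin_mono _ fun t ht => ne_of_gt ht)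
  obtain ⟨t, ht, ht1⟩ := (hs'.and (Ioc_mem_nhdsGT (zero_lt_one (α := ℝ)))).exists
  refine ⟨t, ht1.1, ht1.2, ?_⟩
  rw [slope_def_field, hF0, sub_zero, div_lt_iff₀ ht1.1, zero_mul] at ht
  have h2 : ∑ s, p s * g s ^ t = F t := by
    refine Finset.sum_congr rfl fun s _ => ?_
    by_cases hs0 : p s = 0
    · simp [hs0]
    · rw [Real.rpow_def_of_pos (hg s hs0)]
  linarith

/-! ### From a binning to a protocol -/

section Achievability

variable {X Y Z : Type*}

/-- The protocol in which Alice sends the bin index `f x` and the key is the bin index `k x`. -/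
noncomputable def binningProtocol {n r L : ℕ} (x₀ : X) (f : (Fin n → X) → Fin r → X)
    (k : (Fin n → X) → Fin L) (k' : (Fin n → Y) → (Fin r → X) → Fin L) : Protocol X Y n r L where
  sizeA := 1
  sizeB := 1
  randA := PMF.pure 0
  randB := PMF.pure 0
  aliceSpeaks _ := true
  sendA i x _ _ := f x i
  sendB _ _ _ _ := x₀
  keyA x _ _ := k x
  keyB y _ i := k' y i

theorem discussion_binningProtocol {n r L : ℕ} (x₀ : X) (f : (Fin n → X) → Fin r → X)
    (k : (Fin n → X) → Fin L) (k' : (Fin n → Y) → (Fin r → X) → Fin L)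
    (ω : (binningProtocol x₀ f k k').Outcome Z) :
    (binningProtocol x₀ f k k').discussion ω = f fun i => (ω.1 i).1 := by
  rw [Protocol.discussion_eq_iff]
  exact ⟨fun i _ => rfl, fun i hi => absurd hi (by simp [binningProtocol])⟩

variable [Fintype X] [Fintype Y] [Fintype Z]

/-- The law of the source sequence. -/
noncomputable def iidLaw (P : PMF (X × Y × Z)) (n : ℕ) (s : Fin n → X × Y × Z) : ℝ :=
  ∏ i, pXYZ P (s i)

omit [Fintype X] [Fintype Y] [Fintype Z] in
theorem iidLaw_nonneg (P : PMF (X × Y × Z)) (n : ℕ) (s : Fin n → X × Y × Z) :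
    0 ≤ iidLaw P n s :=
  Finset.prod_nonneg fun _ _ => pXYZ_nonneg P _

/-- Integrates out the private randomness, so that everything can be computed on the source
sequences alone. -/
theorem Protocol.law_weight_source {n r L : ℕ} (S : Protocol X Y n r L) (P : PMF (X × Y × Z))
    {β : Type*} (g : (Fin n → X × Y × Z) → β) :
    law (S.weight P) (fun ω : S.Outcome Z => g ω.1) = law (iidLaw P n) g := by
  classical
  funext b
  have h := S.sum_weight_mul P (fun s => if g s = b then 1 else 0)
  simp only [mul_ite, mul_one, mul_zero] at h
  simp only [law]
  convert h
  rfl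

theorem sum_iidLaw (P : PMF (X × Y × Z)) (n : ℕ) : ∑ s, iidLaw P n s = 1 := by
  simp only [iidLaw]
  rw [sum_prod_eq_pow, sum_pXYZ, one_pow]

theorem condProb_iidLaw {β γ : Type*} (P : PMF (X × Y × Z)) {n : ℕ} (f : X × Y × Z → β)
    (g : X × Y × Z → γ) (s : Fin n → X × Y × Z) :
    condProb (iidLaw P n) (fun s i => f (s i)) (fun s i => g (s i)) s =
      ∏ i, condProb (pXYZ P) f g (s i) := by
  classical
  simp only [condProb]
  rw [Finset.prod_div_distrib]
  congr 1
  · rw [← law_iid (pXYZ P) (fun s => (f s, g s)) (fun i => (f (s i), g (s i)))]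
    simp only [law]
    refine Finset.sum_congr rfl fun s' _ => ?_
    have : (((fun i => f (s' i)), fun i => g (s' i)) = ((fun i => f (s i)), fun i => g (s i))) ↔
        ((fun i => (f (s' i), g (s' i))) = fun i => (f (s i), g (s i))) := by
      simp [funext_iff, forall_and]
    simp only [this]
    rfl
  · exact law_iid (pXYZ P) g (fun i => g (s i))

/-- Single-letterization: the power of a product is a product of powers, so the i.i.d. expectation
is an n-th power. -/
theorem sum_iidLaw_mul_prod_rpow (P : PMF (X × Y × Z)) (n : ℕ) {g : X × Y × Z → ℝ}
    (hg : ∀ s, 0 ≤ g s) (t : ℝ) :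
    ∑ s, iidLaw P n s * (∏ i, g (s i)) ^ t = (∑ s, pXYZ P s * g s ^ t) ^ n := by
  rw [← sum_prod_eq_pow]
  refine Finset.sum_congr rfl fun s _ => ?_
  rw [iidLaw, ← Real.finsetProd_rpow _ _ fun i _ => hg _, Finset.prod_mul_distrib]

/-- A good binning of the source gives a good protocol. -/
theorem exists_protocol_of_binning (P : PMF (X × Y × Z)) {n r L : ℕ} (x₀ : X) (hL : 0 < L)
    (h : (Fin n → X) → Fin L × (Fin r → X)) (k' : (Fin n → Y) → (Fin r → X) → Fin L) {δ : ℝ}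
    (hδ : ∑ s, (if (h fun i => (s i).1).1 ≠ k' (fun i => (s i).2.1) (h fun i => (s i).1).2
        then iidLaw P n s else 0) +
      ∑ s, iidLaw P n s * Real.logb 2 (Fintype.card (Fin L × (Fin r → X)) *
        law (iidLaw P n) (fun s => (h fun i => (s i).1, fun i => (s i).2.2))
          (h fun i => (s i).1, fun i => (s i).2.2) /
        law (iidLaw P n) (fun s i => (s i).2.2) fun i => (s i).2.2) ≤ δ) :
    ∃ S : Protocol X Y n r L, S.errorProb P ≤ δ ∧
      Real.logb 2 L - entropy (S.keyLaw P) ≤ δ ∧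
      S.nonConfusion P + S.nonStealth P ≤ (δ : EReal) := by
  classical
  set S : Protocol X Y n r L := binningProtocol x₀ (fun x => (h x).2) (fun x => (h x).1)
    k' with hS
  have hdisc : ∀ ω : S.Outcome Z, S.discussion ω = (h fun i => (ω.1 i).1).2 :=
    discussion_binningProtocol _ _ _ _
  set W := iidLaw P n with hWdef
  have hW0 : ∀ s, 0 ≤ W s := iidLaw_nonneg P n
  have hW1 : ∑ s, W s = 1 := sum_iidLaw P n
  set K : (Fin n → X × Y × Z) → Fin L := fun s => (h fun i => (s i).1).1 with hK
  set G : (Fin n → X × Y × Z) → (Fin n → Z) × (Fin r → X) :=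
    fun s => (fun i => (s i).2.2, (h fun i => (s i).1).2) with hG
  have hobs : (S.observation : S.Outcome Z → _) = fun ω => G ω.1 := by
    funext ω
    rw [Protocol.observation, hdisc]
  have hkl : S.keyLaw P = law W K := S.law_weight_source P K
  have hol : S.observationLaw P = law W G := by
    rw [Protocol.observationLaw, hobs, S.law_weight_source P G]
  have hjl : S.jointLaw P = law W fun s => (K s, G s) := by
    rw [Protocol.jointLaw, hobs]
    exact S.law_weight_source P fun s => (K s, G s)
  have hL' : (0 : ℝ) < L := by exact_mod_cast hL
  have hX : (0 : ℝ) < Fintype.card X := by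
    have : Nonempty X := ⟨x₀⟩
    exact_mod_cast Fintype.card_pos
  set C : (Fin n → X × Y × Z) → Fin n → Z := fun s i => (s i).2.2 with hC
  -- The meaningless law is P_{Z^n} times the uniform law on discussions, which is why uniform bins
  -- independent of Z^n are exactly what stealth asks for.
  have hmean : ∀ s, meaninglessLaw P n r (G s) =
      law W C (C s) * (1 / (Fintype.card X : ℝ) ^ r) := fun s => by
    rw [meaninglessLaw, hC]
    have := law_iid (pXYZ P) (fun s => s.2.2) (C s)
    rw [hWdef, show iidLaw P n = fun s => ∏ i, pXYZ P (s i) from rfl, this]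
    simp [pZ, hG, hC]
  have hjeq : ∀ s, law W (fun s => (h fun i => (s i).1, C s)) (h fun i => (s i).1, C s) =
      law W (fun s => (K s, G s)) (K s, G s) := fun s => by
    refine law_congr W fun s' => ?_
    simp only [hK, hG, hC, Prod.ext_iff]
    tauto
  have hd1 : divergence (S.jointLaw P) (fun t => S.keyLaw P t.1 * S.observationLaw P t.2) =
      ((∑ s, W s * Real.logb 2 (law W (fun s => (K s, G s)) (K s, G s) /
        (law W K (K s) * law W G (G s))) : ℝ) : EReal) := by
    rw [hjl, hkl, hol]
    exact divergence_law (fun s => (K s, G s)) fun s hs =>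
      mul_ne_zero (law_pos hW0 K hs).ne' (law_pos hW0 G hs).ne'
  have hmne : ∀ s, W s ≠ 0 → meaninglessLaw P n r (G s) ≠ 0 := fun s hs => by
    rw [hmean]
    have := law_pos hW0 C hs
    positivity
  have hd2 : divergence (S.observationLaw P) (meaninglessLaw P n r) =
      ((∑ s, W s * Real.logb 2 (law W G (G s) / meaninglessLaw P n r (G s)) : ℝ) : EReal) := by
    rw [hol]
    exact divergence_law G hmne
  have hd3 : Real.logb 2 L - entropy (S.keyLaw P) =
      ∑ s, W s * Real.logb 2 (law W K (K s) / (1 / L)) := by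
    rw [hkl, entropy_law, sub_neg_eq_add]
    have e1 : Real.logb 2 L = ∑ s, W s * Real.logb 2 L := by rw [← Finset.sum_mul, hW1, one_mul]
    rw [e1, ← Finset.sum_add_distrib]
    refine Finset.sum_congr rfl fun s _ => ?_
    by_cases hs : W s = 0
    · simp [hs]
    · rw [div_div_eq_mul_div, div_one, Real.logb_mul (law_pos hW0 K hs).ne' hL'.ne']
      ring
  have hn1 : 0 ≤ ∑ s, W s * Real.logb 2 (law W (fun s => (K s, G s)) (K s, G s) /
      (law W K (K s) * law W G (G s))) := by
    refine gibbs_law hW0 (fun s => (K s, G s)) (q := fun t => law W K t.1 * law W G t.2)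
      (fun t => mul_nonneg (law_nonneg hW0 _ _) (law_nonneg hW0 _ _)) ?_
      fun s hs => mul_ne_zero (law_pos hW0 K hs).ne' (law_pos hW0 G hs).ne'
    rw [Fintype.sum_prod_type]
    simp only
    rw [← Finset.sum_mul_sum, sum_law, sum_law, hW1, one_mul]
  have hn2 : 0 ≤ ∑ s, W s * Real.logb 2 (law W G (G s) / meaninglessLaw P n r (G s)) := by
    refine gibbs_law hW0 G (meaninglessLaw_nonneg P n r) ?_ hmne
    rw [hW1]
    exact sum_meaninglessLaw_le P n r
  have hn3 : 0 ≤ ∑ s, W s * Real.logb 2 (law W K (K s) / (1 / L)) := by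
    refine gibbs_law hW0 K (q := fun _ => 1 / (L : ℝ)) (fun _ => by positivity) ?_
      fun _ _ => by positivity
    rw [hW1]
    simp [hL'.ne']
  -- The key identity: the joint secrecy divergence is the sum of leakage, non-stealth and
  -- non-uniformity of the key. All three are nonnegative, so a bound on the sum bounds each.
  have hsum : ∑ s, W s * Real.logb 2 (Fintype.card (Fin L × (Fin r → X)) *
        law W (fun s => (h fun i => (s i).1, C s)) (h fun i => (s i).1, C s) / law W C (C s)) =
      ∑ s, W s * Real.logb 2 (law W (fun s => (K s, G s)) (K s, G s) /
        (law W K (K s) * law W G (G s))) +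
      ∑ s, W s * Real.logb 2 (law W G (G s) / meaninglessLaw P n r (G s)) +
      ∑ s, W s * Real.logb 2 (law W K (K s) / (1 / L)) := by
    rw [← Finset.sum_add_distrib, ← Finset.sum_add_distrib]
    refine Finset.sum_congr rfl fun s _ => ?_
    by_cases hs : W s = 0
    · simp [hs]
    have e1 := (law_pos hW0 K hs).ne'
    have e2 := (law_pos hW0 G hs).ne'
    have e3 := (law_pos hW0 C hs).ne'
    have e4 := (law_pos hW0 (fun s => (K s, G s)) hs).ne'
    have e5 := hmne s hs
    rw [hjeq, ← mul_add, ← mul_add, ← Real.logb_mul (by positivity) (by positivity),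
      ← Real.logb_mul (by positivity) (by positivity), hmean]
    congr 2
    have hcard : (Fintype.card (Fin L × (Fin r → X)) : ℝ) = L * (Fintype.card X : ℝ) ^ r := by
      simp
    rw [hcard]
    field_simp
  have herr : S.errorProb P ≤ ∑ s, (if (h fun i => (s i).1).1 ≠
      k' (fun i => (s i).2.1) (h fun i => (s i).1).2 then W s else 0) := by
    have e := S.sum_weight_mul P (fun s => if (h fun i => (s i).1).1 ≠
      k' (fun i => (s i).2.1) (h fun i => (s i).1).2 then (1 : ℝ) else 0)
    simp only [mul_ite, mul_one, mul_zero] at e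
    refine le_trans (Finset.sum_le_sum fun ω _ => ?_) e.le
    by_cases hne : S.key ω ≠ S.keyHat ω
    · rw [if_pos hne, if_pos]
      have hne' : (h fun i => (ω.1 i).1).1 ≠ k' (fun i => (ω.1 i).2.1) (S.discussion ω) := hne
      rwa [hdisc] at hne'
    · rw [if_neg hne]
      split_ifs
      exacts [S.weight_nonneg P ω, le_rfl]
  have herr0 : 0 ≤ ∑ s, (if (h fun i => (s i).1).1 ≠
      k' (fun i => (s i).2.1) (h fun i => (s i).1).2 then W s else 0) := by
    refine Finset.sum_nonneg fun s _ => ?_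
    split_ifs
    exacts [hW0 s, le_rfl]
  have hδ' : _ + _ ≤ δ := hδ
  rw [hsum] at hδ'
  refine ⟨S, by linarith, by rw [hd3]; linarith, ?_⟩
  rw [Protocol.nonConfusion, Protocol.nonStealth, hd1, hd2, ← EReal.coe_add,
    EReal.coe_le_coe_iff]
  linarith

end Achievability

/-! ### Choice of rates and exponents -/

section Rates

variable {X Y Z : Type*} [Fintype X] [Fintype Y] [Fintype Z]

/-- H(X) cancels, leaving H(X|Z) - H(X|Y); the Markov property plays no role here. -/
theorem infoXY_sub_infoXZ (P : PMF (X × Y × Z)) :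
    infoXY P - infoXZ P =
      ∑ s, pXYZ P s * Real.logb 2 (condProb (pXYZ P) (fun s => s.1) (fun s => s.2.1) s) -
      ∑ s, pXYZ P s * Real.logb 2 (condProb (pXYZ P) (fun s => s.1) (fun s => s.2.2) s) := by
  rw [infoXY, infoXZ, mutualInfo_eq, mutualInfo_eq, ← Finset.sum_sub_distrib,
    ← Finset.sum_sub_distrib]
  refine Finset.sum_congr rfl fun s _ => ?_
  by_cases hs : pXYZ P s = 0
  · simp [hs]
  have h0 := pXYZ_nonneg P
  have hx := (law_pos h0 (fun s => s.1) hs).ne'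
  have hy := (law_pos h0 (fun s => s.2.1) hs).ne'
  have hz := (law_pos h0 (fun s => s.2.2) hs).ne'
  have hxy := (law_pos h0 (fun s => (s.1, s.2.1)) hs).ne'
  have hxz := (law_pos h0 (fun s => (s.1, s.2.2)) hs).ne'
  rw [condProb, condProb, Real.logb_div hxy (by positivity), Real.logb_div hxz (by positivity),
    Real.logb_div hxy hy, Real.logb_div hxz hz, Real.logb_mul hx hy, Real.logb_mul hx hz]
  ring

/-- A discussion length whose alphabet size is `2 ^ b` up to a factor `|X|`. -/
theorem exists_discussion_length {c b : ℝ} (hc : 1 < c) (hb : 0 ≤ b) :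
    ∃ r : ℕ, (2 : ℝ) ^ b ≤ c ^ r ∧ c ^ r ≤ c * 2 ^ b := by
  have hl : 0 < Real.logb 2 c := Real.logb_pos one_lt_two hc
  have hc0 : 0 < c := by linarith
  have hpow : ∀ x : ℝ, c ^ x = (2 : ℝ) ^ (Real.logb 2 c * x) := fun x => by
    rw [Real.rpow_mul two_pos.le, Real.rpow_logb two_pos (by norm_num) hc0]
  refine ⟨⌈b / Real.logb 2 c⌉₊, ?_, ?_⟩
  · rw [← Real.rpow_natCast, hpow]
    refine Real.rpow_le_rpow_of_exponent_le one_le_two ?_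
    have := Nat.le_ceil (b / Real.logb 2 c)
    rw [div_le_iff₀ hl] at this
    linarith
  · rw [← Real.rpow_natCast]
    have h1 := (Nat.ceil_lt_add_one (div_nonneg hb hl.le)).le
    refine (Real.rpow_le_rpow_of_exponent_le hc.le h1).trans (le_of_eq ?_)
    rw [Real.rpow_add hc0, Real.rpow_one, hpow, mul_div_cancel₀ _ hl.ne', mul_comm]

theorem sum_logb_scaled {S : Type*} [Fintype S] {p g : S → ℝ} (hp : ∑ s, p s = 1)
    (hg : ∀ s, p s ≠ 0 → 0 < g s) (a : ℝ) :
    ∑ s, p s * Real.logb 2 (2 ^ a * g s) = a + ∑ s, p s * Real.logb 2 (g s) := by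
  have h : a = ∑ s, p s * a := by rw [← Finset.sum_mul, hp, one_mul]
  conv_rhs => rw [h]
  rw [← Finset.sum_add_distrib]
  refine Finset.sum_congr rfl fun s _ => ?_
  by_cases hs : p s = 0
  · simp [hs]
  · rw [Real.logb_mul (Real.rpow_pos_of_pos two_pos _).ne' (hg s hs).ne',
      Real.logb_rpow two_pos (by norm_num)]
    ring

/-- Random binning achieves every rate below `I(X;Y) - I(X;Z)` stealthily. -/
theorem stealthyAchievable_of_lt (P : PMF (X × Y × Z)) {R : ℝ} (hR0 : 0 ≤ R)
    (hR : R < infoXY P - infoXZ P) : StealthyAchievable P R := by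
  classical
  have h0 := pXYZ_nonneg P
  have h1 := sum_pXYZ P
  set cy := condProb (pXYZ P) (fun s => s.1) (fun s => s.2.1) with hcy
  set cz := condProb (pXYZ P) (fun s => s.1) (fun s => s.2.2) with hcz
  have hcy0 : ∀ s, 0 ≤ cy s := condProb_nonneg h0 _ _
  have hcz0 : ∀ s, 0 ≤ cz s := condProb_nonneg h0 _ _
  have hcy' : ∀ s, pXYZ P s ≠ 0 → 0 < cy s := fun s => condProb_pos h0 _ _
  have hcz' : ∀ s, pXYZ P s ≠ 0 → 0 < cz s := fun s => condProb_pos h0 _ _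
  rw [infoXY_sub_infoXZ] at hR
  set hy := ∑ s, pXYZ P s * Real.logb 2 (cy s) with hhy
  set hz := ∑ s, pXYZ P s * Real.logb 2 (cz s) with hhz
  have hy0 : hy ≤ 0 := Finset.sum_nonpos fun s _ => mul_nonpos_of_nonneg_of_nonpos (h0 s)
    (Real.logb_nonpos one_lt_two (hcy0 s) (condProb_le_one h0 _ _ s))
  -- `a` is the rate of the public discussion: above H(X|Y) for decoding, and below H(X|Z) - R for
  -- secrecy and stealth.
  obtain ⟨a, ha1, ha2⟩ := exists_between (show -hy < -hz - R by linarith)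
  have ha0 : 0 < a := by linarith
  have hne : Nonempty X := by
    by_contra hX
    rw [not_nonempty_iff] at hX
    simp at h1
  -- With a single letter H(X|Z) = 0, leaving no room for `a`. At least two letters are needed for
  -- |X|^r to reach 2^{na}.
  have hX1 : 1 < Fintype.card X := by
    by_contra! hX
    have hsub : Subsingleton X := Fintype.card_le_one_iff_subsingleton.1 hX
    have : hz = 0 := Finset.sum_eq_zero fun s _ => by
      by_cases hs : pXYZ P s = 0
      · simp [hs]
      · have e := sum_law_pair_left (pXYZ P) (fun s => s.1) (fun s => s.2.2) s.2.2
        rw [Fintype.sum_subsingleton _ s.1] at e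
        have e' : cz s = 1 := by
          simp only [hcz, condProb]
          rw [e, div_self (law_pos h0 (fun s => s.2.2) hs).ne']
        rw [e', Real.logb_one, mul_zero]
    linarith
  have hXc : (1 : ℝ) < Fintype.card X := by exact_mod_cast hX1
  have h2pos : ∀ x : ℝ, (0 : ℝ) < 2 ^ x := fun x => Real.rpow_pos_of_pos two_pos x
  -- exponents for decoding and for secrecy
  obtain ⟨s, hs0, hs1, hs⟩ := exists_moment_lt_one (g := fun s => 1 / (2 ^ a * cy s)) h1
    (fun s hs => one_div_pos.2 (mul_pos (h2pos a) (hcy' s hs))) (by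
      simp only [one_div, Real.logb_inv, mul_neg, Finset.sum_neg_distrib]
      rw [sum_logb_scaled h1 hcy' a]
      linarith)
  obtain ⟨t, ht0, ht1, ht⟩ := exists_moment_lt_one (g := fun s => 2 ^ (a + R) * cz s) h1
    (fun s hs => mul_pos (h2pos _) (hcz' s hs)) (by
      rw [sum_logb_scaled h1 hcz' (a + R)]
      linarith)
  have hgy : ∀ s, 0 ≤ 1 / (2 ^ a * cy s) := fun s =>
    one_div_nonneg.2 (mul_nonneg (h2pos a).le (hcy0 s))
  have hgz : ∀ s, 0 ≤ 2 ^ (a + R) * cz s := fun s => mul_nonneg (h2pos _).le (hcz0 s)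
  set α := ∑ s', pXYZ P s' * (1 / (2 ^ a * cy s')) ^ s with hα
  set β := ∑ s', pXYZ P s' * (2 ^ (a + R) * cz s') ^ t with hβ
  have hα0 : 0 ≤ α := Finset.sum_nonneg fun _ _ => mul_nonneg (h0 _) (Real.rpow_nonneg (hgy _) _)
  have hβ0 : 0 ≤ β := Finset.sum_nonneg fun _ _ => mul_nonneg (h0 _) (Real.rpow_nonneg (hgz _) _)
  -- The factors 2 and |X| absorb the rounding of L and of r; the denominator comes from
  -- `logb_one_add_le`.
  set κ : ℝ := (2 * Fintype.card X) ^ t / (t * Real.log 2) with hκ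
  have hlim : Filter.Tendsto (fun n : ℕ => α ^ n + κ * β ^ n) Filter.atTop (nhds 0) := by
    have e1 := tendsto_pow_atTop_nhds_zero_of_lt_one hα0 hs
    have e2 := (tendsto_pow_atTop_nhds_zero_of_lt_one hβ0 ht).const_mul κ
    simpa using e1.add e2
  refine ⟨hR0, fun ε hε => ?_⟩
  filter_upwards [hlim.eventually (ge_mem_nhds hε)] with n hn
  obtain ⟨r, hr1, hr2⟩ := exists_discussion_length hXc
    (mul_nonneg (Nat.cast_nonneg n) ha0.le)
  have hL : 0 < ⌈(2 : ℝ) ^ ((n : ℝ) * R)⌉₊ := Nat.ceil_pos.2 (h2pos _)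
  set L := ⌈(2 : ℝ) ^ ((n : ℝ) * R)⌉₊ with hLdef
  have hL2 : (L : ℝ) ≤ 2 * 2 ^ ((n : ℝ) * R) := by
    have e1 := (Nat.ceil_lt_add_one (h2pos ((n : ℝ) * R)).le).le
    have e2 : (1 : ℝ) ≤ 2 ^ ((n : ℝ) * R) :=
      Real.one_le_rpow one_le_two (mul_nonneg (Nat.cast_nonneg n) hR0)
    linarith
  have : Nonempty (Fin L) := ⟨⟨0, hL⟩⟩
  have hscale : ∀ (b : ℝ) (g : X × Y × Z → ℝ) (ω : Fin n → X × Y × Z),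
      ∏ i, (2 ^ b * g (ω i)) = 2 ^ ((n : ℝ) * b) * ∏ i, g (ω i) := fun b g ω => by
    rw [Finset.prod_mul_distrib, Finset.prod_const, Finset.card_univ, Fintype.card_fin,
      ← Real.rpow_natCast, ← Real.rpow_mul two_pos.le, mul_comm b]
  obtain ⟨h, d, hhd⟩ := exists_binning (κ := Fin L) (φ := Fin r → X) (iidLaw_nonneg P n)
    (fun ω i => (ω i).1) (fun ω i => (ω i).2.1) (fun ω i => (ω i).2.2) hs0 hs1 ht0 ht1
  refine ⟨r, exists_protocol_of_binning P (Classical.arbitrary X) hL h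
    (fun y i => (h (d y i)).1) ?_⟩
  refine le_trans ?_ (hhd.trans ?_)
  · refine add_le_add (Finset.sum_le_sum fun ω _ => ?_) le_rfl
    -- If Bob recovers X^n, he applies the same binning and the keys agree.
    by_cases hd : d (fun i => (ω i).2.1) (h fun i => (ω i).1).2 = fun i => (ω i).1
    · simp [hd]
    · rw [if_pos hd]
      split_ifs
      exacts [le_rfl, iidLaw_nonneg P n ω]
  refine le_trans (add_le_add ?_ ?_) hn
  · rw [hα, ← sum_iidLaw_mul_prod_rpow P n hgy s]
    refine Finset.sum_le_sum fun ω _ => ?_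
    by_cases hω : iidLaw P n ω = 0
    · simp [hω]
    have hpos := condProb_pos (iidLaw_nonneg P n) (fun ω i => (ω i).1) (fun ω i => (ω i).2.1) hω
    rw [condProb_iidLaw P (fun s => s.1) (fun s => s.2.1)] at hpos ⊢
    refine mul_le_mul_of_nonneg_left (Real.rpow_le_rpow ?_ ?_ hs0.le) (iidLaw_nonneg P n ω)
    · exact one_div_nonneg.2 (mul_nonneg (Nat.cast_nonneg _) hpos.le)
    · rw [Finset.prod_div_distrib, Finset.prod_const_one, hscale]
      refine one_div_le_one_div_of_le (mul_pos (h2pos _) hpos) ?_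
      refine mul_le_mul_of_nonneg_right ?_ hpos.le
      simpa using hr1
  · rw [hκ, div_mul_eq_mul_div]
    refine div_le_div_of_nonneg_right ?_ (mul_pos ht0 (Real.log_pos one_lt_two)).le
    rw [hβ, ← sum_iidLaw_mul_prod_rpow P n hgz t, Finset.mul_sum]
    refine Finset.sum_le_sum fun ω _ => ?_
    have hnn := condProb_nonneg (iidLaw_nonneg P n) (fun ω i => (ω i).1) (fun ω i => (ω i).2.2) ω
    rw [mul_left_comm, ← Real.mul_rpow (by positivity) (Finset.prod_nonneg fun i _ => hgz _)]
    refine mul_le_mul_of_nonneg_left (Real.rpow_le_rpow ?_ ?_ ht0.le) (iidLaw_nonneg P n ω)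
    · exact mul_nonneg (Nat.cast_nonneg _) hnn
    · rw [condProb_iidLaw P (fun s => s.1) (fun s => s.2.2)] at hnn ⊢
      rw [hscale, ← mul_assoc]
      refine mul_le_mul_of_nonneg_right ?_ hnn
      have hcard : (Fintype.card (Fin L × (Fin r → X)) : ℝ) = L * (Fintype.card X : ℝ) ^ r := by
        simp
      rw [hcard, mul_add, Real.rpow_add two_pos]
      calc (L : ℝ) * (Fintype.card X : ℝ) ^ r
          ≤ (2 * 2 ^ ((n : ℝ) * R)) * (Fintype.card X * 2 ^ ((n : ℝ) * a)) :=
            mul_le_mul hL2 hr2 (by positivity) (by positivity)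
        _ = _ := by ring

/-- The rate `0` needs no discussion and a constant key. -/
theorem stealthyAchievable_zero (P : PMF (X × Y × Z)) : StealthyAchievable P 0 := by
  classical
  have hne : Nonempty X := by
    by_contra hX
    rw [not_nonempty_iff] at hX
    have h1 := sum_pXYZ P
    simp at h1
  refine ⟨le_rfl, fun ε hε => Filter.Eventually.of_forall fun n => ?_⟩
  -- A one-element key set, with r = 0: all defects vanish.
  have hL : ⌈(2 : ℝ) ^ ((n : ℝ) * 0)⌉₊ = 1 := by simp
  rw [hL]
  refine ⟨0, exists_protocol_of_binning P (Classical.arbitrary X) one_pos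
    (fun _ => (0, Fin.elim0)) (fun _ _ => 0) ?_⟩
  have h0 := iidLaw_nonneg P n
  have hlaw : ∀ s : Fin n → X × Y × Z, law (iidLaw P n)
      (fun s => (((0, Fin.elim0) : Fin 1 × (Fin 0 → X)), fun i => (s i).2.2))
        ((0, Fin.elim0), fun i => (s i).2.2) =
      law (iidLaw P n) (fun s i => (s i).2.2) fun i => (s i).2.2 := fun s =>
    law_congr _ fun s' => by simp
  simp only [hlaw]
  refine le_trans (le_of_eq ?_) hε.le
  have hterm : ∀ s : Fin n → X × Y × Z, iidLaw P n s * Real.logb 2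
      ((Fintype.card (Fin 1 × (Fin 0 → X)) : ℝ) *
        law (iidLaw P n) (fun s i => (s i).2.2) (fun i => (s i).2.2) /
        law (iidLaw P n) (fun s i => (s i).2.2) fun i => (s i).2.2) = 0 := fun s => by
    by_cases hs : iidLaw P n s = 0
    · rw [hs, zero_mul]
    · have hC := (law_pos h0 (fun (s : Fin n → X × Y × Z) i => (s i).2.2) hs).ne'
      rw [mul_div_assoc, div_self hC]
      simp
  rw [Finset.sum_congr rfl fun s _ => hterm s]
  simp

end Rates

end StealthyKey

/-! ### The capacities -/

theorem corollary1 {X Y Z : Type*} [Fintype X] [Fintype Y] [Fintype Z]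
    (P : PMF (X × Y × Z)) (hP : StealthyKey.IsMarkovChain P) :
    StealthyKey.stealthyCapacity P =
        ((StealthyKey.infoXY P - StealthyKey.infoXZ P : ℝ) : EReal) ∧
      StealthyKey.secretKeyCapacity P =
        ((StealthyKey.infoXY P - StealthyKey.infoXZ P : ℝ) : EReal) := by
  have hub : StealthyKey.secretKeyCapacity P ≤
      ((StealthyKey.infoXY P - StealthyKey.infoXZ P : ℝ) : EReal) :=
    iSup₂_le fun R hR => EReal.coe_le_coe_iff.2 (hR.le hP)
  have hmono : StealthyKey.stealthyCapacity P ≤ StealthyKey.secretKeyCapacity P :=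
    iSup₂_le fun R hR => le_iSup₂_of_le R hR.achievable le_rfl
  have hlb : ((StealthyKey.infoXY P - StealthyKey.infoXZ P : ℝ) : EReal) ≤
      StealthyKey.stealthyCapacity P := by
    -- Rate 0 is treated separately: when I(X;Y) = I(X;Z) no nonnegative rate lies strictly below
    -- the bound, and the supremum must not be taken over an empty set.
    have hzero : (0 : EReal) ≤ StealthyKey.stealthyCapacity P :=
      le_iSup₂_of_le (f := fun (R : ℝ) (_ : StealthyKey.StealthyAchievable P R) => (R : EReal))
        0 (StealthyKey.stealthyAchievable_zero P) le_rfl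
    refine EReal.ge_of_forall_gt_iff_ge.1 fun R hR => ?_
    rcases lt_or_ge R 0 with hR0 | hR0
    · exact (EReal.coe_nonpos.2 hR0.le).trans hzero
    · exact le_iSup₂_of_le R (StealthyKey.stealthyAchievable_of_lt P hR0
        (EReal.coe_lt_coe_iff.1 hR)) le_rfl
  exact ⟨le_antisymm (hmono.trans hub) hlb, le_antisymm hub (hlb.trans hmono)⟩
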